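/- Let $p$ be a prime and let $G_p\cong\mathbb Z_p$ be a group of order $p$ acting by holomorphic automorphisms on a closed (compact, connected) Riemann surface $\Sigma$. Assume that the action is pseudofree, i.e. that all its fixed points are isolated, and let $\{p_n\}$ be its (possibly empty) fixed point set. Let $D=\sum_n d_n p_n$ be a divisor supported on the fixed points ($d_n\in\mathbb Z$), and let $\mathcal L_D$ be the line bundle $\mathcal O(D)$ on $\Sigma$, with local frame $z_n^{-d_n}$ near $p_n$ ($z_n$ a holomorphic coordinate centred at $p_n$) and frame $1$ away from the $p_n$, with the $G_p$-action on $\mathcal L_D$ which covers the action on $\Sigma$ and preserves the rational section $1$. Write $c_1$ of a complex line bundle on $\Sigma$ as an integer via $H^2(\Sigma;\mathbb Z)\cong\mathbb Z$, i.e. as the number of zeros, counted with index, of a continuous section that is nowhere zero outside finitely many points. Then $\mathcal L_D|_{p_n}\cong (T\Sigma|_{p_n})^{\otimes d_n}$ as $G_p$-representations for all $n$, and $c_1(\mathcal L_D)=\sum_n d_n$. Moreover, if $\mathcal L$ is any (topological) complex $G_p$-line bundle on $\Sigma$ whose fibre at every fixed point satisfies $\mathcal L|_{p_n}\cong (T\Sigma|_{p_n})^{\otimes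 d_n}$ as a complex representation of $G_p$, then $$c_1(\mathcal L)\equiv c_1(\mathcal L_D) \mod p .$$ -/

import Mathlib

open Bundle Filter Topology
open scoped Manifold

/-- The action of `G` on `X` is pseudofree: all its fixed points are isolated. -/
def IsPseudofree (G X : Type*) [Group G] [MulAction G X] [TopologicalSpace X] : Prop :=
  ∀ x ∈ MulAction.fixedPoints G X, ∀ᶠ y in 𝓝[≠] x, y ∉ MulAction.fixedPoints G X

/-- `G` acts on the complex manifold `X` by holomorphic maps. -/
def IsHolomorphicAction (G X : Type*) [Group G] [MulAction G X] [TopologicalSpace X]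
    [ChartedSpace ℂ X] : Prop :=
  ∀ g : G, MDifferentiable 𝓘(ℂ) 𝓘(ℂ) (fun x : X => g • x)

/-- The derivative of `y ↦ g • y` at `x`, a complex linear map from `T_x X` to `T_(g x) X`; both
tangent spaces are `ℂ`, through the preferred charts at `x` and at `g • x`. -/
noncomputable def tangentMapAt {G X : Type*} [Group G] [MulAction G X] [TopologicalSpace X]
    [ChartedSpace ℂ X] (g : G) (x : X) : ℂ →L[ℂ] ℂ :=
  mfderiv 𝓘(ℂ) 𝓘(ℂ) (fun y : X => g • y) x

/-- The linear map `tangentMapAt g x` of complex lines, as a complex number. At a fixed point `x`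
it is the scalar by which `g` acts on the complex line `T_x X`. -/
noncomputable def tangentWeight {G X : Type*} [Group G] [MulAction G X] [TopologicalSpace X]
    [ChartedSpace ℂ X] (g : G) (x : X) : ℂ :=
  tangentMapAt g x 1

/-- A `G`-line bundle structure on a complex line bundle `L` over a `G`-space `X`: an action of
`G` on the total space, by continuous maps that send the fibre over `x` to the fibre over `g • x`
by a complex linear map. -/
structure EquivariantStructure (G : Type*) {X : Type*} [Group G] [MulAction G X]
    (L : X → Type*) [∀ x, AddCommGroup (L x)] [∀ x, Module ℂ (L x)]
    [TopologicalSpace (TotalSpace ℂ L)] where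
  act : G → TotalSpace ℂ L → TotalSpace ℂ L
  act_one : ∀ v, act 1 v = v
  act_mul : ∀ g h v, act (g * h) v = act g (act h v)
  continuous_act : ∀ g, Continuous (act g)
  linear_act : ∀ g x, ∃ A : L x →ₗ[ℂ] L (g • x), ∀ v : L x, act g ⟨x, v⟩ = ⟨g • x, A v⟩

/-- At the fixed point `x`, the fibre `L_x` is isomorphic, as a complex representation of `G`, to
`(T_x X)^{⊗ d}`, which is a complex line on which `g` acts by the scalar `(tangentWeight g x) ^ d`
(for `d < 0`, the tensor power is that of the dual). -/
def EquivariantStructure.FibreIsoTangentPower {G X : Type*} [Group G] [MulAction G X]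
    [TopologicalSpace X] [ChartedSpace ℂ X] {L : X → Type*} [∀ x, AddCommGroup (L x)]
    [∀ x, Module ℂ (L x)] [TopologicalSpace (TotalSpace ℂ L)]
    (ρ : EquivariantStructure G L) (x : X) (d : ℤ) : Prop :=
  ∃ e : L x ≃ₗ[ℂ] ℂ, ∀ (g : G) (v : L x),
    ρ.act g ⟨x, v⟩ = ⟨x, e.symm (tangentWeight g x ^ d * e v)⟩

/-- The loop `γ : [0, 2π] → ℂ ∖ {0}` has winding number `n` around the origin:
it is `exp ∘ θ` with `θ` continuous and `θ (2π) - θ 0 = 2π i n`. -/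
def HasWindingNumber (γ : ℝ → ℂ) (n : ℤ) : Prop :=
  ∃ θ : ℝ → ℂ, ContinuousOn θ (Set.Icc 0 (2 * Real.pi)) ∧
    (∀ t ∈ Set.Icc 0 (2 * Real.pi), γ t = Complex.exp (θ t)) ∧
    θ (2 * Real.pi) - θ 0 = 2 * Real.pi * Complex.I * n

section ChernNumber

variable {X : Type*} [TopologicalSpace X] [ChartedSpace ℂ X]
  (L : X → Type*) [∀ x, AddCommGroup (L x)] [∀ x, Module ℂ (L x)]
  [∀ x, TopologicalSpace (L x)] [TopologicalSpace (TotalSpace ℂ L)] [FiberBundle ℂ L]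

/-- The section `s`, nonzero and continuous on a punctured neighbourhood of `q`, has index `n` at
`q`: in a local trivialization of `L` and a holomorphic chart around `q`, its restriction to every
small enough positively oriented circle about `q` has winding number `n` around the origin. -/
def HasIndexAt (s : ∀ x, L x) (q : X) (n : ℤ) : Prop :=
  ∀ᶠ r : ℝ in 𝓝[>] 0, HasWindingNumber (fun t : ℝ =>
    let y : X := (chartAt ℂ q).symm (chartAt ℂ q q + r * Complex.exp (t * Complex.I))
    (trivializationAt ℂ L q ⟨y, s y⟩).2) n

/-- `n` is the number of zeros, counted with their indices, of a section of `L` that is continuous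
and nowhere zero outside a finite set of points. -/
def IsChernNumber (n : ℤ) : Prop :=
  ∃ (F : Finset X) (s : ∀ x, L x) (k : X → ℤ),
    ContinuousOn (fun x => TotalSpace.mk' ℂ x (s x)) (F : Set X)ᶜ ∧
    (∀ x ∉ F, s x ≠ 0) ∧ (∀ q ∈ F, HasIndexAt L s q (k q)) ∧ ∑ q ∈ F, k q = n

open Classical in
/-- The first Chern class `c₁(L)` of a complex line bundle on a closed Riemann surface, read as an
integer through `H²(X; ℤ) ≅ ℤ` (the complex orientation): the signed count of zeros of a section
with finitely many zeros, which does not depend on the section. -/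
noncomputable def chernNumber : ℤ :=
  if h : ∃ n, IsChernNumber L n then h.choose else 0

end ChernNumber

section DivisorBundle

variable {X : Type*} [TopologicalSpace X] [ChartedSpace ℂ X]

/-- `z_p ^ D(p)`, with `z_p` the preferred holomorphic coordinate centred at `p`. -/
noncomputable def divisorFactor (D : X →₀ ℤ) (p x : X) : ℂ :=
  (chartAt ℂ p x - chartAt ℂ p p) ^ D p

/-- The chart domain around `p`, without the points of the divisor other than `p`. -/
def divisorBaseSet (D : X →₀ ℤ) (p : X) : Set X :=
  (chartAt ℂ p).source ∩ {x | x ∈ D.support → x = p}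

theorem divisorBaseSet_isOpen [T1Space X] (D : X →₀ ℤ) (p : X) : IsOpen (divisorBaseSet D p) := by
  refine (chartAt ℂ p).open_source.inter ?_
  have : {x | x ∈ D.support → x = p} = ((D.support : Set X) \ {p})ᶜ := by
    ext x; simp
  rw [this]
  exact (D.support.finite_toSet.subset Set.sdiff_subset).isClosed.isOpen_compl

theorem divisorFactor_sub_ne {D : X →₀ ℤ} {p x : X} (hx : x ∈ divisorBaseSet D p) (hxp : x ≠ p) :
    chartAt ℂ p x - chartAt ℂ p p ≠ 0 := by
  intro h
  exact hxp ((chartAt ℂ p).injOn hx.1 (mem_chart_source ℂ p) (sub_eq_zero.1 h))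

theorem divisorFactor_ne_zero {D : X →₀ ℤ} {p q x : X} (hpq : p ≠ q)
    (hp : x ∈ divisorBaseSet D p) (hq : x ∈ divisorBaseSet D q) : divisorFactor D p x ≠ 0 := by
  by_cases hxp : x = p
  · subst hxp
    have : D x = 0 := by
      by_contra h
      exact hpq (hq.2 (by simpa using h))
    simp [divisorFactor, this]
  · exact zpow_ne_zero _ (divisorFactor_sub_ne hp hxp)

theorem divisorFactor_continuousOn {D : X →₀ ℤ} {p q : X} (hpq : p ≠ q) :
    ContinuousOn (divisorFactor D p) (divisorBaseSet D p ∩ divisorBaseSet D q) := by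
  by_cases h0 : D p = 0
  · have : divisorFactor D p = fun _ => 1 := by funext x; simp [divisorFactor, h0]
    rw [this]; exact continuousOn_const
  · have hc : ContinuousOn (fun x => chartAt ℂ p x - chartAt ℂ p p)
        (divisorBaseSet D p ∩ divisorBaseSet D q) :=
      ((chartAt ℂ p).continuousOn.mono fun x hx => hx.1.1).sub continuousOn_const
    refine hc.zpow₀ (D p) fun x hx => Or.inl (divisorFactor_sub_ne hx.1 ?_)
    intro hxp
    rw [hxp] at hx
    exact hpq (hx.2.2 (by simpa using h0))

open Classical in
/-- The transition function from the trivialization around `p` to the one around `q`. -/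
noncomputable def divisorTransition (D : X →₀ ℤ) (p q x : X) : ℂ :=
  if p = q then 1 else divisorFactor D q x * (divisorFactor D p x)⁻¹

/-- The line bundle `L_D = O(D)` of the divisor `D = ∑ D(p) p`: it has the local frame
`z_p ^ (-D(p))` around `p`, so that the rational section `1` is represented by `z_p ^ D(p)`. -/
noncomputable def divisorBundle [T2Space X] (D : X →₀ ℤ) : VectorBundleCore ℂ X ℂ X where
  baseSet := divisorBaseSet D
  isOpen_baseSet := divisorBaseSet_isOpen D
  indexAt := id
  mem_baseSet_at p := ⟨mem_chart_source ℂ p, fun _ => rfl⟩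
  coordChange p q x := divisorTransition D p q x • ContinuousLinearMap.id ℂ ℂ
  coordChange_self p x _ v := by simp [divisorTransition]
  continuousOn_coordChange p q := by
    suffices hc : ContinuousOn (divisorTransition D p q)
        (divisorBaseSet D p ∩ divisorBaseSet D q) from hc.smul continuousOn_const
    by_cases h : p = q
    · have : divisorTransition D p q = fun _ => 1 := by funext x; simp [divisorTransition, h]
      rw [this]; exact continuousOn_const
    · have : divisorTransition D p q =
          fun x => divisorFactor D q x * (divisorFactor D p x)⁻¹ := by
        funext x; simp [divisorTransition, h]
      rw [this]
      refine ContinuousOn.mul ?_ (ContinuousOn.inv₀ (divisorFactor_continuousOn h) ?_)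
      · rw [Set.inter_comm]; exact divisorFactor_continuousOn (Ne.symm h)
      · intro x hx; exact divisorFactor_ne_zero h hx.1 hx.2
  coordChange_comp p q r x hx v := by
    obtain ⟨⟨hp, hq⟩, hr⟩ := hx
    by_cases h1 : p = q
    · subst h1; simp [divisorTransition]
    by_cases h2 : q = r
    · subst h2; simp [divisorTransition]
    have hq0 : divisorFactor D q x ≠ 0 := divisorFactor_ne_zero (Ne.symm h1) hq hp
    have hp0 : divisorFactor D p x ≠ 0 := divisorFactor_ne_zero h1 hp hq
    by_cases h3 : p = r
    · subst h3
      simp [divisorTransition, h1, h2]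
      field_simp
    · simp [divisorTransition, h1, h2, h3]
      field_simp

end DivisorBundle

section DivisorAction

theorem divisor_smul_apply {G X : Type*} [Group G] [MulAction G X] {D : X →₀ ℤ}
    (hD : ↑D.support ⊆ MulAction.fixedPoints G X)
    (g : G) (x : X) : D (g • x) = D x := by
  by_cases h : D x = 0
  · by_contra h'
    have hfix := hD (show g • x ∈ (D.support : Set X) by simpa using fun h0 => h' (h0.trans h.symm))
    have := hfix g⁻¹
    rw [inv_smul_smul] at this
    exact h' (by rw [← this])
  · rw [hD (show x ∈ (D.support : Set X) by simpa using h) g]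

variable {G X : Type*} [Group G] [MulAction G X] [TopologicalSpace X] [ChartedSpace ℂ X]

theorem tangentWeight_one (x : X) : tangentWeight (1 : G) x = 1 := by
  have h : (fun y : X => (1 : G) • y) = id := by funext y; simp
  have h2 : tangentMapAt (1 : G) x = ContinuousLinearMap.id ℂ ℂ := by
    unfold tangentMapAt
    rw [h]
    exact mfderiv_id
  rw [tangentWeight, h2]
  rfl

theorem tangentWeight_mul (hG : IsHolomorphicAction G X) (g h : G) (x : X) :
    tangentWeight (g * h) x = tangentWeight g (h • x) * tangentWeight h x := by
  have hc : (fun y : X => (g * h) • y) = (fun y : X => g • y) ∘ fun y : X => h • y := by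
    funext y; simp [mul_smul]
  have h2 : tangentMapAt (g * h) x = (tangentMapAt g (h • x)).comp (tangentMapAt h x) := by
    unfold tangentMapAt
    rw [hc]
    exact mfderiv_comp x (hG g (h • x)) (hG h x)
  have h3 := (tangentMapAt g (h • x)).map_smul (tangentMapAt h x 1) 1
  rw [smul_eq_mul, mul_one, smul_eq_mul] at h3
  rw [tangentWeight, h2, ContinuousLinearMap.comp_apply, h3, mul_comm]
  rfl

theorem tangentWeight_ne_zero (hG : IsHolomorphicAction G X) (g : G) (x : X) :
    tangentWeight g x ≠ 0 := by
  have h := tangentWeight_mul hG g⁻¹ g x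
  rw [inv_mul_cancel, tangentWeight_one] at h
  intro h0
  simp [h0] at h

/-- In the preferred coordinate at a fixed point `x`, the difference quotient of the action of `g`
tends to `tangentWeight g x`. -/
theorem tendsto_tangentWeight [T2Space X] (hG : IsHolomorphicAction G X) (g : G) {x : X}
    (hx : g • x = x) :
    Tendsto (fun y => (chartAt ℂ x (g • y) - chartAt ℂ x x) / (chartAt ℂ x y - chartAt ℂ x x))
      (𝓝[≠] x) (𝓝 (tangentWeight g x)) := by
  have hd := hG g x
  set φ := chartAt ℂ x with hφ
  have hder : HasDerivAt (fun z => φ (g • φ.symm z)) (tangentWeight g x) (φ x) := by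
    have h1 : HasFDerivWithinAt (writtenInExtChartAt 𝓘(ℂ) 𝓘(ℂ) x (fun y => g • y))
        (tangentMapAt g x) (Set.range 𝓘(ℂ)) (extChartAt 𝓘(ℂ) x x) := hd.hasMFDerivAt.2
    have e : writtenInExtChartAt 𝓘(ℂ) 𝓘(ℂ) x (fun y => g • y) = fun z => φ (g • φ.symm z) := by
      funext z
      simp [writtenInExtChartAt, hx, hφ]
    rw [e] at h1
    simp only [modelWithCornersSelf_coe, Set.range_id, hasFDerivWithinAt_univ] at h1
    exact h1.hasDerivAt
  rw [hasDerivAt_iff_tendsto_slope] at hder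
  have hmap : Tendsto φ (𝓝[≠] x) (𝓝[≠] (φ x)) := by
    refine tendsto_nhdsWithin_iff.2
      ⟨(φ.continuousAt (mem_chart_source ℂ x)).tendsto.mono_left nhdsWithin_le_nhds, ?_⟩
    have hs : ∀ᶠ y in 𝓝[≠] x, y ∈ φ.source :=
      nhdsWithin_le_nhds (φ.open_source.mem_nhds (mem_chart_source ℂ x))
    filter_upwards [hs, self_mem_nhdsWithin] with y hy hyx h
    exact hyx (φ.injOn hy (mem_chart_source ℂ x) h)
  refine (hder.comp hmap).congr' ?_
  have hs : ∀ᶠ y in 𝓝[≠] x, y ∈ φ.source :=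
    nhdsWithin_le_nhds (φ.open_source.mem_nhds (mem_chart_source ℂ x))
  filter_upwards [hs] with y hy
  simp [slope, φ.left_inv hy, φ.left_inv (mem_chart_source ℂ x), hx, div_eq_inv_mul]

/-- The action of `g` on `L_D`, for a divisor `D` supported on the fixed point set. It sends the
rational section `1` to itself: away from the divisor it is `(x, v) ↦ (g x, v)` in the frame `1`,
and at a point `x` of the divisor it is `v ↦ (tangentWeight g x) ^ D(x) v`, which extends it
continuously. -/
noncomputable def divisorAct [T2Space X] (D : X →₀ ℤ) (g : G) :
    TotalSpace ℂ (divisorBundle D).Fiber → TotalSpace ℂ (divisorBundle D).Fiber :=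
  fun v => ⟨g • v.1, (tangentWeight g v.1 ^ D v.1) • v.2⟩

theorem divisorAct_coord_continuousAt [T2Space X] (hG : IsHolomorphicAction G X)
    {D : X →₀ ℤ} (hD : ↑D.support ⊆ MulAction.fixedPoints G X) (g : G) (x₀ : X) :
    ContinuousAt (fun x => divisorTransition D (g • x) (g • x₀) (g • x) *
      (tangentWeight g x ^ D x * divisorTransition D x₀ x x)) x₀ := by
  have hfac : ∀ x, D x = 0 → ∀ y, divisorFactor D x y = 1 := by
    intro x hx y; simp [divisorFactor, hx]
  have hout : ∀ᶠ x in 𝓝[≠] x₀, D x = 0 := by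
    have : IsOpen ((D.support : Set X) \ {x₀})ᶜ :=
      (D.support.finite_toSet.subset Set.sdiff_subset).isClosed.isOpen_compl
    have hm : x₀ ∈ ((D.support : Set X) \ {x₀})ᶜ := by simp
    filter_upwards [nhdsWithin_le_nhds (this.mem_nhds hm), self_mem_nhdsWithin] with x hx hne
    by_contra h
    exact hx ⟨by simpa using h, hne⟩
  rw [continuousAt_iff_punctured_nhds]
  have hself : divisorTransition D (g • x₀) (g • x₀) (g • x₀) *
      (tangentWeight g x₀ ^ D x₀ * divisorTransition D x₀ x₀ x₀) = tangentWeight g x₀ ^ D x₀ := by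
    simp [divisorTransition]
  rw [hself]
  by_cases h0 : D x₀ = 0
  · refine tendsto_const_nhds.congr' ?_
    filter_upwards [hout] with x hx
    have hgx : D (g • x) = 0 := by rw [divisor_smul_apply hD, hx]
    have hgx0 : D (g • x₀) = 0 := by rw [divisor_smul_apply hD, h0]
    simp [divisorTransition, hfac _ h0, hfac _ hx, hfac _ hgx, hfac _ hgx0, h0, hx]
  · have hfix : g • x₀ = x₀ := hD (show x₀ ∈ (D.support : Set X) by simpa using h0) g
    have ht := (tendsto_tangentWeight hG g hfix).zpow₀ (D x₀)
      (Or.inl (tangentWeight_ne_zero hG g x₀))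
    refine ht.congr' ?_
    filter_upwards [hout, self_mem_nhdsWithin] with x hx hne
    have hne' : x ≠ x₀ := hne
    have hgx : D (g • x) = 0 := by rw [divisor_smul_apply hD, hx]
    have hgne : g • x ≠ x₀ := fun h => hne' (by rw [← hfix] at h; exact smul_left_cancel g h)
    rw [hfix]
    rw [divisorTransition, if_neg hgne, divisorTransition, if_neg hne'.symm, hfac _ hx,
      hfac _ hgx, hx, div_zpow]
    simp [divisorFactor, div_eq_mul_inv]

/-- `L_D` as a `G`-line bundle. -/
noncomputable def divisorEquivariantStructure [T2Space X] (hG : IsHolomorphicAction G X)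
    (D : X →₀ ℤ) (hD : ↑D.support ⊆ MulAction.fixedPoints G X) :
    EquivariantStructure G (divisorBundle D).Fiber where
  act := divisorAct D
  act_one v := by
    obtain ⟨x, v⟩ := v
    change ℂ at v
    have h2 : tangentWeight (1 : G) x ^ D x * v = v := by
      rw [tangentWeight_one, one_zpow, one_mul]
    have h1 : (1 : G) • x = x := one_smul G x
    change TotalSpace.mk (F := ℂ) (E := fun _ : X => ℂ) ((1 : G) • x)
      (tangentWeight (1 : G) x ^ D x * v) = TotalSpace.mk x v
    rw [h2, h1]
  act_mul g h v := by
    obtain ⟨x, v⟩ := v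
    change ℂ at v
    have h2 : tangentWeight (g * h) x ^ D x * v =
        tangentWeight g (h • x) ^ D (h • x) * (tangentWeight h x ^ D x * v) := by
      rw [tangentWeight_mul hG, mul_zpow, divisor_smul_apply hD, mul_assoc]
    change TotalSpace.mk (F := ℂ) (E := fun _ : X => ℂ) ((g * h) • x)
      (tangentWeight (g * h) x ^ D x * v) = TotalSpace.mk (g • h • x)
        (tangentWeight g (h • x) ^ D (h • x) * (tangentWeight h x ^ D x * v))
    rw [h2, mul_smul]
  continuous_act g := by
    rw [continuous_iff_continuousAt]
    intro v₀
    have hproj : Continuous (fun v : TotalSpace ℂ (divisorBundle D).Fiber => v.1) :=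
      FiberBundle.continuous_proj ℂ (divisorBundle D).Fiber
    rw [FiberBundle.continuousAt_totalSpace]
    refine ⟨((hG g).continuous.comp hproj).continuousAt, ?_⟩
    have hu : ContinuousAt (fun v : TotalSpace ℂ (divisorBundle D).Fiber =>
        (trivializationAt ℂ (divisorBundle D).Fiber v₀.1 v).2) v₀ :=
      ((FiberBundle.continuousAt_totalSpace ℂ id).1 continuousAt_id).2
    have hc := (divisorAct_coord_continuousAt hG hD g v₀.1).comp
      (f := fun v : TotalSpace ℂ (divisorBundle D).Fiber => v.1) hproj.continuousAt
    refine (hc.mul hu).congr ?_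
    have hb : ∀ᶠ v : TotalSpace ℂ (divisorBundle D).Fiber in 𝓝 v₀,
        v.1 ∈ divisorBaseSet D v₀.1 :=
      hproj.continuousAt ((divisorBaseSet_isOpen D v₀.1).mem_nhds
        ((divisorBundle D).mem_baseSet_at v₀.1))
    filter_upwards [hb] with v hv
    obtain ⟨x, v⟩ := v
    have key : ∀ u : ℂ, divisorTransition D v₀.1 x x * (divisorTransition D x v₀.1 x * u) = u := by
      intro u
      have := (divisorBundle D).coordChange_comp x v₀.1 x x
        ⟨⟨(divisorBundle D).mem_baseSet_at x, hv⟩, (divisorBundle D).mem_baseSet_at x⟩ u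
      exact this.trans ((divisorBundle D).coordChange_self x x
        ((divisorBundle D).mem_baseSet_at x) u)
    change ℂ at v
    change divisorTransition D (g • x) (g • v₀.1) (g • x) *
      (tangentWeight g x ^ D x * divisorTransition D v₀.1 x x) *
      (divisorTransition D x v₀.1 x * v) =
      divisorTransition D (g • x) (g • v₀.1) (g • x) * (tangentWeight g x ^ D x * v)
    linear_combination divisorTransition D (g • x) (g • v₀.1) (g • x) *
      tangentWeight g x ^ D x * key v
  linear_act g x := ⟨(tangentWeight g x ^ D x • LinearMap.id : ℂ →ₗ[ℂ] ℂ), fun _ => rfl⟩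

end DivisorAction

/-! The number `c₁(L)` may be counted with any section that is continuous and nonzero off a finite
set, so the congruence follows by counting with an equivariant section `s`. The index of `s` is
constant on orbits, and outside the fixed points every orbit has exactly `p` elements because the
stabilizers are trivial. If `s` has index `D x` at each fixed point `x`, then the index minus `D` is
an invariant function that vanishes at the fixed points, so its sum is divisible by `p`
(`prime_dvd_finsum`). The sum of `D` is `c₁(L_D)`, since the rational section 1 has index `D q` at
every `q`.

To build `s` near a fixed point, average `z ^ d` times a local frame over `G`. On the fibre `g` acts
by the `d`-th power of its tangent weight, and `z ^ d` composed with `g⁻¹` contributes the inverse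
factor. All summands therefore agree to leading order, and the average behaves like `|G| z ^ d`.
Elsewhere the action is free: a small disc is disjoint from its translates, so a section may be
chosen on the disc and carried around the orbit (`union_disc`). Finitely many such steps cover the
surface. Each creates only finitely many zeros, because a nowhere zero function on a compact subset
of the plane extends with finitely many zeros on a disc, by Tietze, smoothing and Sard
(`exists_extension_finite_zeros`).

The count is independent of the section because the quotient of two sections is a function whose
local degrees add up to zero (`IsGenericUnit.totalDegree_eq_zero`). Such a function is changed to
the constant 1, one coordinate disc at a time. Each change multiplies it by a function that is 1 off
a disc, and for those the claim is planar: outside a large disc a function has the form `z ^ n * exp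
H` with `n` the sum of its local degrees (`exists_eq_zpow_sum_mul_exp`), which forces `n = 0` when
the function is 1 there. Writing local degree as `f = z ^ k * exp h`, rather than through loops,
makes its multiplicativity formal. -/

/-! ### Continuous logarithms and winding numbers -/

theorem Continuous.exists_eq_exp {u : ℂ → ℂ} (hu : Continuous u) (h0 : ∀ z, u z ≠ 0) :
    ∃ H : ℂ → ℂ, Continuous H ∧ ∀ z, u z = Complex.exp (H z) := by
  have hs : IsSimplyConnected (Set.univ : Set ℂ) := by
    have := (convex_univ (𝕜 := ℝ) (E := ℂ)).contractibleSpace Set.univ_nonempty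
    exact SimplyConnectedSpace.ofContractible _
  obtain ⟨H, hH, he⟩ := Complex.exists_continuousOn_eqOn_exp_comp hs isOpen_univ
    (g := u) hu.continuousOn (by simpa using h0)
  exact ⟨H, by simpa using hH, fun z => (he (Set.mem_univ z)).symm⟩

/-- A continuous function with values in `2πiℤ` on a preconnected set is constant. -/
theorem IsPreconnected.eq_of_exp_eq_one {Y : Type*} [TopologicalSpace Y] {S : Set Y}
    (hS : IsPreconnected S) {δ : Y → ℂ} (hδ : ContinuousOn δ S)
    (h1 : ∀ t ∈ S, Complex.exp (δ t) = 1) {a b : Y} (ha : a ∈ S) (hb : b ∈ S) : δ a = δ b := by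
  have : DiscreteTopology (Set.range ((↑) : ℤ → ℝ)) :=
    Int.isClosedEmbedding_coe_real.isEmbedding.toHomeomorph.symm.isEmbedding.discreteTopology
  have hT : ∀ t ∈ S, ∃ n : ℤ, δ t = n * (2 * Real.pi * Complex.I) := fun t ht =>
    Complex.exp_eq_one_iff.1 (h1 t ht)
  have hc : ContinuousOn (fun t => (δ t / (2 * Real.pi * Complex.I)).re) S :=
    Complex.continuous_re.comp_continuousOn (hδ.div_const _)
  have hn : ∀ t (n : ℤ), δ t = n * (2 * Real.pi * Complex.I) →
      (δ t / (2 * Real.pi * Complex.I)).re = (n : ℝ) := fun t n h => by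
    rw [h, mul_div_cancel_right₀ _ Complex.two_pi_I_ne_zero, Complex.intCast_re]
  have key := hS.constant_of_mapsTo ⟨this⟩ hc (T := Set.range ((↑) : ℤ → ℝ))
    (fun t ht => by
      obtain ⟨n, hn'⟩ := hT t ht
      exact ⟨n, (hn t n hn').symm⟩) ha hb
  obtain ⟨m, hm⟩ := hT a ha
  obtain ⟨n, hn'⟩ := hT b hb
  simp only [hn a m hm, hn b n hn', Int.cast_inj] at key
  rw [hm, hn', key]

/-- Two continuous logarithms of the same loop differ by a continuous function with values in
`2πiℤ`, hence by a constant, so their increments agree. -/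
theorem HasWindingNumber.unique {γ : ℝ → ℂ} {m n : ℤ} (hm : HasWindingNumber γ m)
    (hn : HasWindingNumber γ n) : m = n := by
  obtain ⟨θ, hθ, he, h2⟩ := hm
  obtain ⟨θ', hθ', he', h2'⟩ := hn
  have hpi := Real.pi_pos
  have h0 : (0 : ℝ) ∈ Set.Icc 0 (2 * Real.pi) := ⟨le_rfl, by positivity⟩
  have h1 : (2 * Real.pi) ∈ Set.Icc 0 (2 * Real.pi) := ⟨by positivity, le_rfl⟩
  have key := (isPreconnected_Icc (a := 0) (b := 2 * Real.pi)).eq_of_exp_eq_one (hθ.sub hθ')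
    (fun t ht => by
      rw [Pi.sub_apply, Complex.exp_sub, ← he t ht, ← he' t ht, div_self]
      rw [he t ht]; exact Complex.exp_ne_zero _) h0 h1
  simp only [Pi.sub_apply] at key
  have h3 : (2 * Real.pi * Complex.I : ℂ) * (m - n) = 0 := by
    linear_combination -h2 + h2' - key
  have h4 : (2 * Real.pi * Complex.I : ℂ) ≠ 0 := Complex.two_pi_I_ne_zero
  have := (mul_eq_zero.1 h3).resolve_left h4
  exact_mod_cast sub_eq_zero.1 this

/-- A power function that agrees with the exponential of a continuous function on a circle has
exponent zero. -/
theorem zpow_eq_zero_of_eq_exp {n : ℤ} {r : ℝ} (hr : 0 < r) {H : ℂ → ℂ}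
    (hH : ContinuousOn H (Metric.sphere 0 r))
    (h : ∀ z ∈ Metric.sphere (0 : ℂ) r, z ^ n = Complex.exp (H z)) : n = 0 := by
  have hr' : (r : ℂ) ≠ 0 := by exact_mod_cast hr.ne'
  have hmem : ∀ t : ℝ, (r * Complex.exp (t * Complex.I) : ℂ) ∈ Metric.sphere (0 : ℂ) r := by
    intro t; simp [Complex.norm_exp_ofReal_mul_I, abs_of_pos hr]
  -- The loop `z ^ n` has two logarithms: the explicit one has increment `2πin`, while the one
  -- through `H` returns to its starting value.
  refine HasWindingNumber.unique (γ := fun t : ℝ => (r * Complex.exp (t * Complex.I)) ^ n)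
    ⟨fun t => n * (Complex.log r + t * Complex.I), by fun_prop, ?_, ?_⟩
    ⟨fun t => H (r * Complex.exp (t * Complex.I)), ?_, ?_, ?_⟩
  · intro t _
    rw [Complex.exp_int_mul, Complex.exp_add, Complex.exp_log hr']
  · push_cast; ring
  · exact hH.comp (by fun_prop) fun t _ => hmem t
  · intro t _; exact h _ (hmem t)
  · simp

/-! ### Extension of planar functions with finitely many zeros -/

theorem exists_continuous_eqOn {K : Set ℂ} (hK : IsClosed K) {f : ℂ → ℂ}
    (hf : ContinuousOn f K) : ∃ h : ℂ → ℂ, Continuous h ∧ Set.EqOn h f K := by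
  obtain ⟨g, hg⟩ := ContinuousMap.exists_restrict_eq hK
    (⟨K.domRestrict f, continuousOn_iff_continuous_domRestrict.1 hf⟩ : C(K, ℂ))
  exact ⟨g, g.continuous, fun z hz => congrArg (fun k : C(K, ℂ) => k ⟨z, hz⟩) hg⟩

/-- Near `z` the constant `f z` is within `ε` of `f`. Balls are convex, so a smooth partition of
unity glues these local constants. -/
theorem exists_contDiff_approx {f : ℂ → ℂ} (hf : Continuous f) {ε : ℝ} (hε : 0 < ε) :
    ∃ g : ℂ → ℂ, ContDiff ℝ 1 g ∧ ∀ z, ‖g z - f z‖ < ε := by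
  obtain ⟨g, hg⟩ := exists_contMDiffMap_forall_mem_convex_of_local_const (n := 1) 𝓘(ℝ, ℂ)
    (t := fun z => Metric.ball (f z) ε) (fun z => convex_ball _ _) (fun z => ⟨f z, by
      have := hf.continuousAt (x := z)
      filter_upwards [this (Metric.ball_mem_nhds _ hε)] with y hy
      rw [Metric.mem_ball, dist_comm]; exact hy⟩)
  exact ⟨g, g.contMDiff.contDiff, fun z => by simpa [dist_eq_norm] using hg z⟩

/-- Almost every translate of a `C¹` map of the plane has finitely many zeros on a disc. -/
theorem exists_small_finite_fibre {g : ℂ → ℂ} (hg : ContDiff ℝ 1 g) {ε : ℝ} (hε : 0 < ε)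
    (R : ℝ) : ∃ c : ℂ, ‖c‖ < ε ∧ {z ∈ Metric.closedBall 0 R | g z = c}.Finite := by
  -- Sard's theorem in equal dimensions: the set of critical values is null, so it does not contain
  -- the ball of radius `ε`.
  set S : Set ℂ := {z | (fderiv ℝ g z).det = 0}
  have hS : MeasureTheory.volume (g '' S) = 0 :=
    MeasureTheory.addHaar_image_eq_zero_of_det_fderivWithin_eq_zero _
      (fun z _ => (hg.differentiable one_ne_zero z).hasFDerivAt.hasFDerivWithinAt)
      (fun z hz => hz)
  obtain ⟨c, hc, hcS⟩ : ∃ c ∈ Metric.ball (0 : ℂ) ε, c ∉ g '' S := by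
    by_contra! h
    have := MeasureTheory.measure_mono_null (fun x hx => h x hx) hS
    exact (Metric.measure_ball_pos MeasureTheory.volume (0 : ℂ) hε).ne' this
  refine ⟨c, by simpa using hc, ?_⟩
  have hcl : IsClosed {z | g z = c} := isClosed_eq hg.continuous continuous_const
  have hcpt : IsCompact {z ∈ Metric.closedBall 0 R | g z = c} :=
    (isCompact_closedBall 0 R).inter_right hcl
  -- Over a regular value the derivative is invertible, so the points of the fibre are isolated;
  -- compactness makes the fibre finite.
  refine hcpt.finite (isDiscrete_iff_nhdsNE.2 fun z hz => ?_)
  have hdet : (fderiv ℝ g z).det ≠ 0 := fun h => hcS ⟨z, h, hz.2⟩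
  have hanti : ∃ C, AntilipschitzWith C (fderiv ℝ g z) :=
    ⟨_, ((fderiv ℝ g z).toContinuousLinearEquivOfDetNeZero hdet).antilipschitz⟩
  have := (hg.differentiable one_ne_zero z).hasFDerivAt.eventually_ne (c := c) hanti
  rw [inf_principal_eq_bot]
  filter_upwards [this] with y hy h
  exact hy h.2

/-- A continuous nowhere zero function on a compact set of the plane extends to a
continuous function with finitely many zeros on a given disc. -/
theorem exists_extension_finite_zeros {K : Set ℂ} (hK : IsCompact K) {f : ℂ → ℂ}
    (hf : ContinuousOn f K) (h0 : ∀ z ∈ K, f z ≠ 0) (R : ℝ) :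
    ∃ h : ℂ → ℂ, Continuous h ∧ Set.EqOn h f K ∧
      {z ∈ Metric.closedBall 0 R | h z = 0}.Finite := by
  obtain ⟨f0, hf0, hf0K⟩ := exists_continuous_eqOn hK.isClosed hf
  obtain ⟨δ, hδ, hδK⟩ : ∃ δ > 0, ∀ z ∈ K, δ ≤ ‖f z‖ := by
    rcases K.eq_empty_or_nonempty with rfl | hne
    · exact ⟨1, one_pos, by simp⟩
    · obtain ⟨z, hz, hmin⟩ := hK.exists_isMinOn hne hf.norm
      exact ⟨‖f z‖, norm_pos_iff.2 (h0 z hz), fun w hw => hmin hw⟩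
  -- One half of `δ` is spent on smoothing and the other on the shift to a regular value. On `K` the
  -- quotient `(g - c) / f` then stays within distance 1 of 1, where the principal logarithm is
  -- continuous.
  obtain ⟨g, hg, hgf⟩ := exists_contDiff_approx hf0 (half_pos hδ)
  obtain ⟨c, hc, hfin⟩ := exists_small_finite_fibre hg (half_pos hδ) R
  have hclose : ∀ z ∈ K, ‖(g z - c) / f z - 1‖ < 1 := by
    intro z hz
    have e : (g z - c) / f z - 1 = ((g z - f0 z) - c) / f z := by
      rw [hf0K hz]; field_simp [h0 z hz]; ring
    rw [e, norm_div, div_lt_one (norm_pos_iff.2 (h0 z hz))]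
    calc _ ≤ ‖g z - f0 z‖ + ‖c‖ := norm_sub_le _ _
      _ < δ / 2 + δ / 2 := add_lt_add (hgf z) hc
      _ = δ := by ring
      _ ≤ _ := hδK z hz
  have hslit : ∀ z ∈ K, (g z - c) / f z ∈ Complex.slitPlane := fun z hz => by
    have := Complex.mem_slitPlane_of_norm_lt_one (hclose z hz)
    simpa using this
  have hlog : ContinuousOn (fun z => Complex.log ((g z - c) / f z)) K :=
    ((hg.continuous.continuousOn.sub continuousOn_const).div hf h0).clog hslit
  -- Multiplication by `exp (-l)`, with `l` extending this logarithm, restores `f` on `K` without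
  -- creating zeros.
  obtain ⟨l, hl, hlK⟩ := exists_continuous_eqOn hK.isClosed hlog
  refine ⟨fun z => (g z - c) * Complex.exp (-l z),
    (hg.continuous.sub continuous_const).mul (Complex.continuous_exp.comp hl.neg), ?_, ?_⟩
  · intro z hz
    have hne := Complex.slitPlane_ne_zero (hslit z hz)
    have h1 : g z - c ≠ 0 := fun h => by simp [h] at hne
    simp only
    rw [hlK hz, Complex.exp_neg, Complex.exp_log hne]
    field_simp [h0 z hz]
  · refine hfin.subset fun z hz => ⟨hz.1, ?_⟩
    have := (mul_eq_zero.1 hz.2).resolve_right (Complex.exp_ne_zero _)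
    exact sub_eq_zero.1 this

/-! ### Local degree of a function at an isolated singularity -/

section LocalDegree

variable {X : Type*} [TopologicalSpace X] [ChartedSpace ℂ X]

/-- The preferred holomorphic coordinate around `q`, centred at `q`. -/
noncomputable def centredChart (q y : X) : ℂ := chartAt ℂ q y - chartAt ℂ q q

/-- The function `f`, continuous and nonzero on a punctured neighbourhood of `q`, has local degree
`k` at `q`: it is the `k`-th power of a coordinate times the exponential of a continuous
function. -/
def HasLocalDegree (f : X → ℂ) (q : X) (k : ℤ) : Prop :=
  ∃ h : X → ℂ, (∀ᶠ y in 𝓝[≠] q, ContinuousAt h y) ∧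
    ∀ᶠ y in 𝓝[≠] q, f y = centredChart q y ^ k * Complex.exp (h y)

@[simp] theorem centredChart_self (q : X) : centredChart q q = 0 := sub_self _

@[simp] theorem centredChart_complex (q y : ℂ) : centredChart q y = y - q := rfl

theorem eventually_mem_chart_source (q : X) : ∀ᶠ y in 𝓝 q, y ∈ (chartAt ℂ q).source :=
  (chartAt ℂ q).open_source.mem_nhds (mem_chart_source ℂ q)

theorem centredChart_ne_zero {q y : X} (hy : y ∈ (chartAt ℂ q).source) (hne : y ≠ q) :
    centredChart q y ≠ 0 := fun h =>
  hne ((chartAt ℂ q).injOn hy (mem_chart_source ℂ q) (sub_eq_zero.1 h))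

theorem eventually_centredChart_ne_zero (q : X) : ∀ᶠ y in 𝓝[≠] q, centredChart q y ≠ 0 := by
  filter_upwards [nhdsWithin_le_nhds (eventually_mem_chart_source q), self_mem_nhdsWithin]
    with y hy hne
  exact centredChart_ne_zero hy hne

theorem continuousAt_centredChart {q y : X} (hy : y ∈ (chartAt ℂ q).source) :
    ContinuousAt (centredChart q) y :=
  ((chartAt ℂ q).continuousAt hy).sub continuousAt_const

theorem eventually_continuousAt_centredChart (q : X) :
    ∀ᶠ y in 𝓝 q, ContinuousAt (centredChart q) y :=
  (eventually_mem_chart_source q).mono fun _ => continuousAt_centredChart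

/-- The inverse of the coordinate `centredChart q`. -/
noncomputable def centredParam (q : X) (w : ℂ) : X := (chartAt ℂ q).symm (chartAt ℂ q q + w)

theorem centredParam_centredChart {q y : X} (hy : y ∈ (chartAt ℂ q).source) :
    centredParam q (centredChart q y) = y := by
  simp [centredParam, centredChart, (chartAt ℂ q).left_inv hy]

@[simp] theorem centredParam_zero (q : X) : centredParam q 0 = q := by
  simp [centredParam]

theorem eventually_mem_chart_target (q : X) :
    ∀ᶠ w in 𝓝 (0 : ℂ), chartAt ℂ q q + w ∈ (chartAt ℂ q).target := by
  have h : Tendsto (fun w : ℂ => chartAt ℂ q q + w) (𝓝 0) (𝓝 (chartAt ℂ q q)) := by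
    simpa using (continuous_const_add (chartAt ℂ q q)).tendsto 0
  exact h ((chartAt ℂ q).open_target.mem_nhds (mem_chart_target ℂ q))

theorem centredChart_centredParam {q : X} {w : ℂ} (hw : chartAt ℂ q q + w ∈ (chartAt ℂ q).target) :
    centredChart q (centredParam q w) = w := by
  simp [centredParam, centredChart, (chartAt ℂ q).right_inv hw]

theorem continuousAt_centredParam {q : X} {w : ℂ}
    (hw : chartAt ℂ q q + w ∈ (chartAt ℂ q).target) : ContinuousAt (centredParam q) w :=
  ContinuousAt.comp (f := fun w => chartAt ℂ q q + w)
    ((chartAt ℂ q).symm.continuousAt (by simpa using hw)) (continuous_const_add _).continuousAt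

theorem tendsto_centredParam (q : X) : Tendsto (centredParam q) (𝓝[≠] 0) (𝓝[≠] q) := by
  refine tendsto_nhdsWithin_iff.2 ⟨?_, ?_⟩
  · have := (continuousAt_centredParam (q := q) (eventually_mem_chart_target q).self_of_nhds)
    rw [ContinuousAt, centredParam_zero] at this
    exact this.mono_left nhdsWithin_le_nhds
  · filter_upwards [nhdsWithin_le_nhds (eventually_mem_chart_target q), self_mem_nhdsWithin]
      with w hw hne h
    rw [Set.mem_singleton_iff] at h
    apply hne
    rw [Set.mem_singleton_iff, ← centredChart_centredParam hw, h, centredChart_self]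

/-- A property of the points near `q` holds on all small coordinate circles around `q`. -/
theorem exists_centredParam_disc {q : X} {P : X → Prop} (hP : ∀ᶠ y in 𝓝[≠] q, P y) :
    ∃ ε > 0, ∀ w : ℂ, w ≠ 0 → ‖w‖ < ε →
      chartAt ℂ q q + w ∈ (chartAt ℂ q).target ∧ P (centredParam q w) := by
  have h1 := ((eventually_mem_chart_target q).filter_mono nhdsWithin_le_nhds).and
    ((tendsto_centredParam q).eventually hP)
  obtain ⟨ε, hε, h⟩ := Metric.mem_nhdsWithin_iff.1 h1
  exact ⟨ε, hε, fun w hw hlt => h ⟨by simpa using hlt, hw⟩⟩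

namespace HasLocalDegree

variable {f g : X → ℂ} {q : X} {m n k : ℤ}

theorem congr (hf : HasLocalDegree f q k) (h : f =ᶠ[𝓝[≠] q] g) : HasLocalDegree g q k := by
  obtain ⟨l, hl, hfl⟩ := hf
  refine ⟨l, hl, ?_⟩
  filter_upwards [hfl, h] with y h1 h2
  rw [← h2, h1]

theorem mul (hf : HasLocalDegree f q m) (hg : HasLocalDegree g q n) :
    HasLocalDegree (fun y => f y * g y) q (m + n) := by
  obtain ⟨a, ha, hfa⟩ := hf
  obtain ⟨b, hb, hgb⟩ := hg
  refine ⟨fun y => a y + b y, by filter_upwards [ha, hb] with y h1 h2 using h1.add h2, ?_⟩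
  filter_upwards [hfa, hgb, eventually_centredChart_ne_zero q] with y h1 h2 h3
  rw [h1, h2, zpow_add₀ h3, Complex.exp_add]
  ring

theorem zpow (hf : HasLocalDegree f q m) (n : ℤ) :
    HasLocalDegree (fun y => f y ^ n) q (m * n) := by
  obtain ⟨a, ha, hfa⟩ := hf
  refine ⟨fun y => n * a y, by filter_upwards [ha] with y h1 using h1.const_mul _, ?_⟩
  filter_upwards [hfa] with y h1
  rw [h1, mul_zpow, zpow_mul, Complex.exp_int_mul]

theorem div (hf : HasLocalDegree f q m) (hg : HasLocalDegree g q n) :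
    HasLocalDegree (fun y => f y / g y) q (m - n) := by
  have := hf.mul (hg.zpow (-1))
  rw [mul_neg_one, ← sub_eq_add_neg] at this
  simpa [div_eq_mul_inv] using this

/-- Near `q` the quotient `f / c` is close to 1, so the principal logarithm supplies the exponent.
-/
theorem of_tendsto {c : ℂ} (hc : c ≠ 0) (hf : ∀ᶠ y in 𝓝[≠] q, ContinuousAt f y)
    (h : Tendsto f (𝓝[≠] q) (𝓝 c)) : HasLocalDegree f q 0 := by
  have h1 : ∀ᶠ y in 𝓝[≠] q, f y / c ∈ Complex.slitPlane := by
    have h2 : Tendsto (fun y => f y / c) (𝓝[≠] q) (𝓝 1) := by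
      simpa [div_self hc] using h.div_const c
    exact h2 (Complex.isOpen_slitPlane.mem_nhds Complex.one_mem_slitPlane)
  refine ⟨fun y => Complex.log (f y / c) + Complex.log c, ?_, ?_⟩
  · filter_upwards [h1, hf] with y h2 h3
    exact ((h3.div_const c).clog h2).add continuousAt_const
  · filter_upwards [h1] with y h2
    rw [Complex.exp_add, Complex.exp_log (Complex.slitPlane_ne_zero h2), Complex.exp_log hc,
      zpow_zero, one_mul, div_mul_cancel₀ _ hc]

theorem of_continuousAt (hf : ∀ᶠ y in 𝓝 q, ContinuousAt f y) (h0 : f q ≠ 0) :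
    HasLocalDegree f q 0 :=
  of_tendsto h0 (nhdsWithin_le_nhds hf) (hf.self_of_nhds.mono_left nhdsWithin_le_nhds)

theorem exp {h : X → ℂ} (hh : ∀ᶠ y in 𝓝[≠] q, ContinuousAt h y) :
    HasLocalDegree (fun y => Complex.exp (h y)) q 0 :=
  ⟨h, hh, by simp⟩

theorem centredChart (q : X) : HasLocalDegree (centredChart q) q 1 :=
  ⟨fun _ => 0, by simp [continuousAt_const], by simp⟩

/-- On a circle `log r + it` is a logarithm of the coordinate, while `h` returns to its starting
value, so only the factor `z ^ k` winds. -/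
theorem eventually_hasWindingNumber (hf : HasLocalDegree f q k) :
    ∀ᶠ r : ℝ in 𝓝[>] 0, HasWindingNumber
      (fun t : ℝ => f (centredParam q (r * Complex.exp (t * Complex.I)))) k := by
  obtain ⟨h, hh, hfh⟩ := hf
  obtain ⟨ε, hε, H⟩ := exists_centredParam_disc (hh.and hfh)
  filter_upwards [Ioo_mem_nhdsGT hε] with r hr
  have hr0 : (r : ℂ) ≠ 0 := by exact_mod_cast hr.1.ne'
  have hw : ∀ t : ℝ, (r * Complex.exp (t * Complex.I) : ℂ) ≠ 0 := fun t =>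
    mul_ne_zero hr0 (Complex.exp_ne_zero _)
  have hn : ∀ t : ℝ, ‖(r * Complex.exp (t * Complex.I) : ℂ)‖ < ε := fun t => by
    simpa [Complex.norm_exp_ofReal_mul_I, abs_of_pos hr.1] using hr.2
  refine ⟨fun t => k * (Complex.log r + t * Complex.I) +
    h (centredParam q (r * Complex.exp (t * Complex.I))), ?_, ?_, ?_⟩
  · refine ContinuousOn.add (by fun_prop) (Continuous.continuousOn ?_)
    rw [continuous_iff_continuousAt]
    intro t
    obtain ⟨h1, h2, -⟩ := H _ (hw t) (hn t)
    exact (h2.comp (continuousAt_centredParam h1)).comp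
      (f := fun t : ℝ => (r * Complex.exp (t * Complex.I) : ℂ)) (by fun_prop)
  · intro t _
    obtain ⟨h1, -, h2⟩ := H _ (hw t) (hn t)
    simp only
    rw [h2, centredChart_centredParam h1, Complex.exp_add, Complex.exp_int_mul, Complex.exp_add,
      Complex.exp_log hr0]
  · have : Complex.exp ((2 * Real.pi : ℝ) * Complex.I) = Complex.exp ((0 : ℝ) * Complex.I) := by
      simp
    simp only [this]
    push_cast
    ring

theorem unique (hm : HasLocalDegree f q m) (hn : HasLocalDegree f q n) : m = n := by
  obtain ⟨r, h1, h2⟩ := (hm.eventually_hasWindingNumber.and hn.eventually_hasWindingNumber).exists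
  exact h1.unique h2

end HasLocalDegree

/-- The exponential map makes the half-plane `U` the universal cover of the punctured disc, and
there `u ∘ exp` has a logarithm `Θ`. The increment of `Θ` under the deck transformation `w ↦ w +
2πi` is a constant `2πik`, so `Θ w - k w` is periodic and descends to the punctured disc. -/
theorem exists_eq_zpow_mul_exp {u : ℂ → ℂ} {ε : ℝ} (hε : 0 < ε)
    (hu : ∀ w, w ≠ 0 → ‖w‖ < ε → ContinuousAt u w ∧ u w ≠ 0) :
    ∃ (k : ℤ) (h : ℂ → ℂ), ∀ w, w ≠ 0 → ‖w‖ < ε →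
      ContinuousAt h w ∧ u w = w ^ k * Complex.exp (h w) := by
  set U : Set ℂ := {w | w.re < Real.log ε}
  have hUo : IsOpen U := isOpen_lt Complex.continuous_re continuous_const
  have hUc : Convex ℝ U := convex_halfSpace_re_lt _
  have hUs : IsSimplyConnected U := by
    have := hUc.contractibleSpace ⟨((Real.log ε - 1 : ℝ) : ℂ), by simp [U]⟩
    exact SimplyConnectedSpace.ofContractible _
  have hUe : ∀ w, w ∈ U ↔ ‖Complex.exp w‖ < ε := fun w => by
    rw [Complex.norm_exp, ← Real.lt_log_iff_exp_lt hε]; rfl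
  obtain ⟨Θ, hΘ, he⟩ := Complex.exists_continuousOn_eqOn_exp_comp hUs hUo
    (g := fun w => u (Complex.exp w))
    (fun w hw => ((hu _ (Complex.exp_ne_zero w) ((hUe w).1 hw)).1.comp
      Complex.continuous_exp.continuousAt).continuousWithinAt)
    (by
      rintro ⟨w, hw, h0⟩
      exact (hu _ (Complex.exp_ne_zero w) ((hUe w).1 hw)).2 h0)
  have hper : ∀ w ∈ U, ∀ n : ℤ, w + n * (2 * Real.pi * Complex.I) ∈ U := fun w hw n => by
    rw [hUe] at hw ⊢
    rwa [Complex.exp_periodic.int_mul n w]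
  have hshift : ∀ w ∈ U, w + 2 * Real.pi * Complex.I ∈ U := fun w hw => by
    simpa using hper w hw 1
  have hexp : ∀ w ∈ U, Complex.exp (Θ (w + 2 * Real.pi * Complex.I) - Θ w) = 1 := by
    intro w hw
    have h1 := he hw
    have h2 := he (hshift w hw)
    simp only [Function.comp_apply, Complex.exp_periodic w] at h1 h2
    rw [Complex.exp_sub, h1, h2, div_self]
    exact (hu _ (Complex.exp_ne_zero w) ((hUe w).1 hw)).2
  have hcont : ContinuousOn (fun w => Θ (w + 2 * Real.pi * Complex.I) - Θ w) U :=
    (hΘ.comp (by fun_prop) hshift).sub hΘ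
  have hw0 : Complex.log (ε / 2 : ℝ) ∈ U := by
    rw [hUe, Complex.exp_log (by exact_mod_cast (half_pos hε).ne')]
    simp [abs_of_pos hε]
    linarith
  obtain ⟨k, hk⟩ := Complex.exp_eq_one_iff.1 (hexp _ hw0)
  have hk' : ∀ w ∈ U, Θ (w + 2 * Real.pi * Complex.I) = Θ w + k * (2 * Real.pi * Complex.I) := by
    intro w hw
    have := hUc.isPreconnected.eq_of_exp_eq_one hcont hexp hw hw0
    simp only [hk] at this
    rw [← this]; ring
  have hnat : ∀ n : ℕ, ∀ w ∈ U, Θ (w + n * (2 * Real.pi * Complex.I)) =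
      Θ w + k * (n * (2 * Real.pi * Complex.I)) := by
    intro n
    induction n with
    | zero => simp
    | succ n ih =>
      intro w hw
      have h1 := hk' (w + n * (2 * Real.pi * Complex.I)) (by simpa using hper w hw n)
      rw [ih w hw] at h1
      push_cast
      rw [show w + (n + 1) * (2 * Real.pi * Complex.I) =
        w + n * (2 * Real.pi * Complex.I) + 2 * Real.pi * Complex.I by ring, h1]
      ring
  have hint : ∀ a ∈ U, ∀ b, Complex.exp a = Complex.exp b → Θ b - k * b = Θ a - k * a := by
    intro a ha b hab
    obtain ⟨n, hn⟩ := Complex.exp_eq_exp_iff_exists_int.1 hab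
    have hb : b ∈ U := by rw [hUe] at ha ⊢; rwa [← hab]
    obtain ⟨n, rfl | rfl⟩ := n.eq_nat_or_neg
    · have := hnat n b hb
      rw [hn]
      push_cast
      rw [this]; ring
    · have := hnat n a ha
      have e : b = a + n * (2 * Real.pi * Complex.I) := by rw [hn]; push_cast; ring
      rw [e, this]; ring
  refine ⟨k, fun w => Θ (Complex.log w) - k * Complex.log w, fun w hw hlt => ?_⟩
  have hlog : Complex.log w ∈ U := by rwa [hUe, Complex.exp_log hw]
  constructor
  -- The principal logarithm may jump at `w`. The branch `log (z / w) + log w` is continuous there,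
  -- and by periodicity it gives the same value of `Θ v - k v`.
  · have hc : ContinuousAt (fun z => Complex.log (z / w) + Complex.log w) w := by
      refine ContinuousAt.add (ContinuousAt.clog (by fun_prop) ?_) continuousAt_const
      simp [div_self hw]
    have hv : Complex.log (w / w) + Complex.log w = Complex.log w := by simp [div_self hw]
    have h1 : ContinuousAt (fun v => Θ v - k * v) (Complex.log (w / w) + Complex.log w) := by
      rw [hv]
      exact (hΘ.continuousAt (hUo.mem_nhds hlog)).sub (by fun_prop)
    refine (h1.comp (f := fun z => Complex.log (z / w) + Complex.log w) hc).congr ?_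
    have h2 : ∀ᶠ z in 𝓝 w, z ≠ 0 ∧ ‖z‖ < ε :=
      (continuousAt_id.eventually_ne hw).and
        (continuous_norm.continuousAt.eventually_lt continuousAt_const hlt)
    filter_upwards [h2] with z hz
    refine hint _ (by rw [hUe, Complex.exp_log hz.1]; exact hz.2) _ ?_
    rw [Complex.exp_add, Complex.exp_log hz.1, Complex.exp_log (div_ne_zero hz.1 hw),
      Complex.exp_log hw, div_mul_cancel₀ _ hw]
  · have h1 := he hlog
    simp only [Function.comp_apply, Complex.exp_log hw] at h1
    rw [← h1, Complex.exp_sub, Complex.exp_int_mul, Complex.exp_log hw]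
    field_simp

theorem exists_hasLocalDegree {f : X → ℂ} {q : X}
    (hf : ∀ᶠ y in 𝓝[≠] q, ContinuousAt f y ∧ f y ≠ 0) : ∃ k, HasLocalDegree f q k := by
  obtain ⟨ε, hε, H⟩ := exists_centredParam_disc hf
  obtain ⟨k, h, hh⟩ := exists_eq_zpow_mul_exp (u := fun w => f (centredParam q w)) hε
    fun w hw hlt => by
      obtain ⟨h1, h2, h3⟩ := H w hw hlt
      exact ⟨h2.comp (continuousAt_centredParam h1), h3⟩
  have hev : ∀ᶠ y in 𝓝[≠] q, y ∈ (chartAt ℂ q).source ∧ centredChart q y ≠ 0 ∧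
      ‖centredChart q y‖ < ε := by
    refine ((eventually_mem_chart_source q).filter_mono nhdsWithin_le_nhds).and
      ((eventually_centredChart_ne_zero q).and (Eventually.filter_mono nhdsWithin_le_nhds ?_))
    have := (continuousAt_centredChart (mem_chart_source ℂ q)).norm
    exact this.eventually_lt continuousAt_const (by simpa using hε)
  refine ⟨k, fun y => h (centredChart q y), ?_, ?_⟩
  · filter_upwards [hev] with y hy
    exact (hh _ hy.2.1 hy.2.2).1.comp (continuousAt_centredChart hy.1)
  · filter_upwards [hev] with y hy
    have := (hh _ hy.2.1 hy.2.2).2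
    rwa [centredParam_centredChart hy.1] at this

/-- Some local degree exists; comparing winding numbers on a single small circle identifies it. -/
theorem HasLocalDegree.of_eventually_hasWindingNumber {f : X → ℂ} {q : X} {k : ℤ}
    (hf : ∀ᶠ y in 𝓝[≠] q, ContinuousAt f y ∧ f y ≠ 0)
    (hk : ∀ᶠ r : ℝ in 𝓝[>] 0, HasWindingNumber
      (fun t : ℝ => f (centredParam q (r * Complex.exp (t * Complex.I)))) k) :
    HasLocalDegree f q k := by
  obtain ⟨m, hm⟩ := exists_hasLocalDegree hf
  obtain ⟨r, h1, h2⟩ := (hm.eventually_hasWindingNumber.and hk).exists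
  rwa [← h1.unique h2]

/-- The local degree is invariant under holomorphic changes of coordinates. -/
theorem HasLocalDegree.comp {Y : Type*} [TopologicalSpace Y] [ChartedSpace ℂ Y] {f : Y → ℂ}
    {φ : X → Y} {q : X} {k : ℤ} {c : ℂ} (hf : HasLocalDegree f (φ q) k)
    (hφ : ∀ᶠ y in 𝓝 q, ContinuousAt φ y) (hc : c ≠ 0)
    (hd : Tendsto (fun y => _root_.centredChart (φ q) (φ y) / _root_.centredChart q y)
      (𝓝[≠] q) (𝓝 c)) :
    HasLocalDegree (fun y => f (φ y)) q k := by
  obtain ⟨h, hh, hfh⟩ := hf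
  have ht : Tendsto φ (𝓝[≠] q) (𝓝[≠] (φ q)) := by
    refine tendsto_nhdsWithin_iff.2 ⟨hφ.self_of_nhds.mono_left nhdsWithin_le_nhds, ?_⟩
    filter_upwards [hd.eventually_ne hc] with y hy h0
    rw [Set.mem_singleton_iff] at h0
    simp [h0] at hy
  have hcont : ∀ᶠ y in 𝓝[≠] q, ContinuousAt (fun y => _root_.centredChart (φ q) (φ y)) y := by
    filter_upwards [nhdsWithin_le_nhds hφ, (ht.mono_right nhdsWithin_le_nhds).eventually
      (eventually_mem_chart_source (φ q))] with y h1 h2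
    exact (continuousAt_centredChart h2).comp h1
  -- The pulled-back coordinate is the coordinate at `q` times a ratio with limit `c ≠ 0`, which has
  -- degree 0.
  have hratio : HasLocalDegree
      (fun y => _root_.centredChart (φ q) (φ y) / _root_.centredChart q y) q 0 := by
    refine of_tendsto hc ?_ hd
    filter_upwards [hcont, eventually_centredChart_ne_zero q,
      nhdsWithin_le_nhds (eventually_continuousAt_centredChart q)] with y h1 h2 h3
    exact h1.div h3 h2
  have hexp : HasLocalDegree (fun y => Complex.exp (h (φ y))) q 0 := by
    refine HasLocalDegree.exp ?_
    filter_upwards [nhdsWithin_le_nhds hφ, ht.eventually hh] with y h1 h2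
    exact h2.comp h1
  have := (((HasLocalDegree.centredChart q).mul hratio).zpow k).mul hexp
  simp only [add_zero, one_mul] at this
  refine this.congr ?_
  filter_upwards [eventually_centredChart_ne_zero q, ht.eventually hfh] with y h1 h2
  rw [mul_div_cancel₀ _ h1, h2]

end LocalDegree

/-- The transition maps in both directions are holomorphic and compose to the identity near the
point, so by the chain rule neither derivative vanishes. -/
theorem hasDerivAt_chart_transition {X : Type*} [TopologicalSpace X] [ChartedSpace ℂ X]
    [IsManifold 𝓘(ℂ) 1 X] {x q : X} (hq : q ∈ (chartAt ℂ x).source) :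
    ∃ c : ℂ, c ≠ 0 ∧ HasDerivAt (chartAt ℂ q ∘ (chartAt ℂ x).symm) c (chartAt ℂ x q) := by
  have hd : ∀ a b : X, q ∈ (chartAt ℂ a).source → q ∈ (chartAt ℂ b).source →
      DifferentiableAt ℂ (chartAt ℂ b ∘ (chartAt ℂ a).symm) (chartAt ℂ a q) := by
    intro a b ha hb
    have h := contDiffWithinAt_ext_coord_change (I := 𝓘(ℂ)) (n := 1) b a
      (y := chartAt ℂ a q) (by simp [ha, hb])
    simp only [extChartAt, mfld_simps] at h
    rw [contDiffWithinAt_univ] at h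
    exact h.differentiableAt one_ne_zero
  have h1 := (hd x q hq (mem_chart_source ℂ q)).hasDerivAt
  have h2 := (hd q x (mem_chart_source ℂ q) hq).hasDerivAt
  refine ⟨_, fun h0 => ?_, h1⟩
  have e : (chartAt ℂ q ∘ (chartAt ℂ x).symm) (chartAt ℂ x q) = chartAt ℂ q q := by
    simp [(chartAt ℂ x).left_inv hq]
  rw [← e] at h2
  have h3 := h2.comp (chartAt ℂ x q) h1
  rw [h0, mul_zero] at h3
  have h4 : HasDerivAt (fun z : ℂ => z) 0 (chartAt ℂ x q) := by
    refine h3.congr_of_eventuallyEq ?_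
    have ht : ∀ᶠ z in 𝓝 (chartAt ℂ x q), z ∈ (chartAt ℂ x).target :=
      (chartAt ℂ x).open_target.mem_nhds ((chartAt ℂ x).map_source hq)
    have hs : ∀ᶠ z in 𝓝 (chartAt ℂ x q), (chartAt ℂ x).symm z ∈ (chartAt ℂ q).source := by
      have := (chartAt ℂ x).continuousAt_symm ((chartAt ℂ x).map_source hq)
      rw [ContinuousAt, (chartAt ℂ x).left_inv hq] at this
      exact this ((chartAt ℂ q).open_source.mem_nhds (mem_chart_source ℂ q))
    filter_upwards [ht, hs] with z hz hz'
    simp [(chartAt ℂ q).left_inv hz', (chartAt ℂ x).right_inv hz]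
  exact one_ne_zero ((hasDerivAt_id' _).unique h4)

theorem HasLocalDegree.comp_chart_symm {X : Type*} [TopologicalSpace X] [ChartedSpace ℂ X]
    [IsManifold 𝓘(ℂ) 1 X] {x q : X} {f : X → ℂ} {k : ℤ} (hf : HasLocalDegree f q k)
    (hq : q ∈ (chartAt ℂ x).source) :
    HasLocalDegree (fun z => f ((chartAt ℂ x).symm z)) (chartAt ℂ x q) k := by
  obtain ⟨c, hc, hd⟩ := hasDerivAt_chart_transition hq
  have e := (chartAt ℂ x).left_inv hq
  refine HasLocalDegree.comp (c := c) (by rwa [e]) ?_ hc ?_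
  · filter_upwards [(chartAt ℂ x).open_target.mem_nhds ((chartAt ℂ x).map_source hq)] with z hz
    exact (chartAt ℂ x).continuousAt_symm hz
  · rw [e]
    refine (hasDerivAt_iff_tendsto_slope.1 hd).congr fun z => ?_
    simp only [slope, vsub_eq_sub, smul_eq_mul, Function.comp_apply, e, centredChart_complex]
    rw [← div_eq_inv_mul]; rfl

/-! ### Sum of local degrees in the plane -/

section Planar

/-- Singularities are removed one at a time. Division by `(z - q) ^ k q` leaves `exp h` near `q`,
and cutting `h` off to zero around `q` removes the singularity without altering the function
elsewhere. Once none is left, the function has a logarithm on the whole plane. -/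
theorem exists_eq_zpow_sum_mul_exp {R : ℝ} (hR : 0 < R) (k : ℂ → ℤ) (F : Finset ℂ)
    (hF : ∀ q ∈ F, ‖q‖ < R) {g : ℂ → ℂ} (hg : ∀ z ∉ F, ContinuousAt g z ∧ g z ≠ 0)
    (hk : ∀ q ∈ F, HasLocalDegree g q (k q)) :
    ∃ H : ℂ → ℂ, ContinuousOn H {z | R ≤ ‖z‖} ∧
      ∀ z, R ≤ ‖z‖ → g z = z ^ (∑ q ∈ F, k q) * Complex.exp (H z) := by
  induction F using Finset.induction_on generalizing g with
  | empty =>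
    obtain ⟨H, hH, h⟩ := (continuous_iff_continuousAt.2 fun z => (hg z (by simp)).1).exists_eq_exp
      fun z => (hg z (by simp)).2
    exact ⟨H, hH.continuousOn, fun z _ => by simpa using h z⟩
  | insert q F hqF ih =>
    have hsub : ∀ z : ℂ, ContinuousAt (fun z => z - q) z := fun z => by fun_prop
    set g₁ : ℂ → ℂ := fun z => g z * (z - q) ^ (-k q) with hg₁
    have hg₁c : ∀ z ∉ insert q F, ContinuousAt g₁ z ∧ g₁ z ≠ 0 := fun z hz => by
      have hzq : z - q ≠ 0 := fun h => hz (by simp [sub_eq_zero.1 h])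
      exact ⟨(hg z hz).1.mul ((hsub z).zpow₀ _ (Or.inl hzq)),
        mul_ne_zero (hg z hz).2 (zpow_ne_zero _ hzq)⟩
    have hdq : HasLocalDegree g₁ q 0 := by
      have := (hk q (by simp)).mul ((HasLocalDegree.centredChart q).zpow (-k q))
      simpa [hg₁] using this
    obtain ⟨h, hh, hgh⟩ := hdq
    have hqF' : ∀ᶠ z in 𝓝 q, z ∉ F :=
      F.finite_toSet.isClosed.isOpen_compl.mem_nhds (by simpa using hqF)
    have hnear : ∀ᶠ z in 𝓝 q, z ∉ F ∧ ‖z‖ < R :=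
      hqF'.and
        (continuous_norm.continuousAt.eventually_lt continuousAt_const (hF q (by simp)))
    obtain ⟨ε, hε, hball⟩ := Metric.mem_nhdsWithin_iff.1
      ((hh.and hgh).and (hnear.filter_mono nhdsWithin_le_nhds))
    have hball' : ∀ z, z ≠ q → ‖z - q‖ < ε → ContinuousAt h z ∧ g₁ z = Complex.exp (h z) ∧
        z ∉ F ∧ ‖z‖ < R := fun z hz hlt => by
      obtain ⟨⟨h1, h2⟩, h3, h4⟩ := hball ⟨by simpa [dist_eq_norm] using hlt, hz⟩
      exact ⟨h1, by simpa using h2, h3, h4⟩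
    -- The cutoff is 0 for `‖z - q‖ < ε / 4` and 1 for `‖z - q‖ ≥ ε / 2`.
    set χ : ℂ → ℝ := fun z => max 0 (min 1 (4 * ‖z - q‖ / ε - 1)) with hχ
    have hχc : Continuous χ := by fun_prop
    have hχ0 : ∀ z, ‖z - q‖ < ε / 4 → χ z = 0 := fun z hz => by
      have : 4 * ‖z - q‖ / ε < 1 := by rw [div_lt_one hε]; linarith
      exact max_eq_left ((min_le_right _ _).trans (by linarith))
    have hχ1 : ∀ z, ε / 2 ≤ ‖z - q‖ → χ z = 1 := fun z hz => by
      have : 2 ≤ 4 * ‖z - q‖ / ε := by rw [le_div_iff₀ hε]; linarith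
      simp only [hχ]
      rw [min_eq_left (by linarith), max_eq_right zero_le_one]
    classical
    -- Nothing is known about `h` at `q` itself; since `χ` vanishes around `q`, the new function is
    -- identically 1 there.
    set g₂ : ℂ → ℂ := fun z => if ‖z - q‖ < ε then Complex.exp (χ z * h z) else g₁ z with hg₂
    have hfar : ∀ z, ε / 2 ≤ ‖z - q‖ → g₂ z = g₁ z := fun z hz => by
      by_cases hlt : ‖z - q‖ < ε
      · have hne : z ≠ q := by
          rintro rfl; simp at hz; linarith
        simp only [hg₂, if_pos hlt, hχ1 z hz, (hball' z hne hlt).2.1]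
        simp
      · simp only [hg₂, if_neg hlt]
    have hopen : ∀ (z : ℂ) (a : ℝ), ‖z - q‖ < a → ∀ᶠ y in 𝓝 z, ‖y - q‖ < a := fun z a hz =>
      (hsub z).norm.eventually_lt continuousAt_const hz
    have hfar' : ∀ z, ε ≤ ‖z - q‖ → g₂ =ᶠ[𝓝 z] g₁ := fun z hz => by
      have : ∀ᶠ y in 𝓝 z, ε / 2 < ‖y - q‖ :=
        continuousAt_const.eventually_lt (hsub z).norm (by linarith)
      exact this.mono fun y hy => hfar y hy.le
    have hg₂c : ∀ z ∉ F, ContinuousAt g₂ z ∧ g₂ z ≠ 0 := by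
      intro z hz
      by_cases hlt : ‖z - q‖ < ε
      · refine ⟨?_, by simp only [hg₂, if_pos hlt]; exact Complex.exp_ne_zero _⟩
        by_cases hzq : z = q
        · have : ∀ᶠ y in 𝓝 z, ‖y - q‖ < ε / 4 := hopen z _ (by simp [hzq, hε])
          refine (continuousAt_const (y := (1 : ℂ))).congr ?_
          filter_upwards [this] with y hy
          have hy' : ‖y - q‖ < ε := by linarith
          simp [hg₂, if_pos hy', hχ0 y hy]
        · have hc : ContinuousAt (fun y => Complex.exp (χ y * h y)) z :=
            ((Complex.continuous_ofReal.comp hχc).continuousAt.mul (hball' z hzq hlt).1).cexp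
          refine hc.congr ?_
          filter_upwards [hopen z _ hlt] with y hy
          simp only [hg₂, if_pos hy]
      · have hz' : z ∉ insert q F := by
          simp only [Finset.mem_insert, not_or]
          exact ⟨by rintro rfl; simp [hε] at hlt, hz⟩
        have he := hfar' z (not_lt.1 hlt)
        exact ⟨(hg₁c z hz').1.congr he.symm, by rw [he.self_of_nhds]; exact (hg₁c z hz').2⟩
    have hk₂ : ∀ p ∈ F, HasLocalDegree g₂ p (k p) := by
      intro p hp
      have hpq : p ≠ q := fun h => hqF (h ▸ hp)
      have hfar_p : ε ≤ ‖p - q‖ := by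
        by_contra! hlt
        exact (hball' p hpq hlt).2.2.1 hp
      have h1 : HasLocalDegree (fun z => (z - q) ^ (-k q)) p 0 := by
        have hne : ∀ᶠ z in 𝓝 p, z - q ≠ 0 := (hsub p).eventually_ne (sub_ne_zero.2 hpq)
        refine HasLocalDegree.of_continuousAt ?_ (zpow_ne_zero _ (sub_ne_zero.2 hpq))
        exact hne.mono fun z hz => (hsub z).zpow₀ _ (Or.inl hz)
      have h2 := (hk p (by simp [hp])).mul h1
      rw [add_zero] at h2
      exact h2.congr ((hfar' p hfar_p).symm.filter_mono nhdsWithin_le_nhds)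
    obtain ⟨H, hH, hgH⟩ := ih (fun p hp => hF p (by simp [hp])) hg₂c hk₂
    have hz0 : ∀ z : ℂ, R ≤ ‖z‖ → z ≠ 0 := fun z hz h => by simp [h] at hz; linarith
    have hslit : ∀ z : ℂ, R ≤ ‖z‖ → 1 - q / z ∈ Complex.slitPlane := fun z hz => by
      have : ‖-(q / z)‖ < 1 := by
        rw [norm_neg, norm_div, div_lt_one (by linarith)]
        exact (hF q (by simp)).trans_le hz
      simpa [sub_eq_add_neg] using Complex.mem_slitPlane_of_norm_lt_one this
    refine ⟨fun z => H z + k q * Complex.log (1 - q / z), ?_, ?_⟩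
    · refine hH.add (continuousOn_const.mul (ContinuousOn.clog ?_ hslit))
      exact continuousOn_const.sub (continuousOn_const.div continuousOn_id hz0)
    · intro z hz
      have hzq : z ≠ q := fun h => by
        have := hF q (by simp)
        rw [h] at hz
        linarith
      have hfar_z : ε / 2 ≤ ‖z - q‖ := by
        by_contra! hlt
        have := (hball' z hzq (by linarith)).2.2.2
        linarith
      have h1 := hgH z hz
      rw [hfar z hfar_z] at h1
      -- Since `‖q / z‖ < 1`, the number `1 - q / z` has a continuous logarithm, so `z - q`
      -- contributes one power of `z` outside the disc.
      have h2 : z - q = z * Complex.exp (Complex.log (1 - q / z)) := by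
        rw [Complex.exp_log (Complex.slitPlane_ne_zero (hslit z hz))]
        field_simp [hz0 z hz]
      have h3 : g z = g₁ z * (z - q) ^ k q := by
        simp only [hg₁]
        rw [mul_assoc, ← zpow_add₀ (sub_ne_zero.2 hzq), neg_add_cancel, zpow_zero, mul_one]
      rw [h3, h1, h2, Finset.sum_insert hqF, mul_zpow, Complex.exp_add, Complex.exp_int_mul,
        zpow_add₀ (hz0 z hz)]
      ring

/-- The local degrees of a function on the plane that is constant near infinity add up to zero. -/
theorem sum_localDegree_eq_zero_of_eq_one {R : ℝ} (hR : 0 < R) (k : ℂ → ℤ) (F : Finset ℂ)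
    (hF : ∀ q ∈ F, ‖q‖ < R) {g : ℂ → ℂ} (hg : ∀ z ∉ F, ContinuousAt g z ∧ g z ≠ 0)
    (hk : ∀ q ∈ F, HasLocalDegree g q (k q)) (h1 : ∀ z, R ≤ ‖z‖ → g z = 1) :
    ∑ q ∈ F, k q = 0 := by
  obtain ⟨H, hH, h⟩ := exists_eq_zpow_sum_mul_exp hR k F hF hg hk
  refine zpow_eq_zero_of_eq_exp hR (H := fun z => -H z)
    (hH.neg.mono fun z hz => by simp at hz; simp [hz]) fun z hz => ?_
  have hz' : R ≤ ‖z‖ := by simp at hz; simp [hz]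
  have := h z hz'
  rw [h1 z hz'] at this
  rw [Complex.exp_neg]
  exact eq_inv_of_mul_eq_one_left this.symm

end Planar

/-! ### Total degree of a function on a closed Riemann surface -/

section GenericUnit

variable {X : Type*} [TopologicalSpace X]

/-- The function `f` is continuous and nonzero outside a finite set. -/
def IsGenericUnit (f : X → ℂ) : Prop := ∀ᶠ y in cofinite, ContinuousAt f y ∧ f y ≠ 0

theorem eventually_nhdsNE_of_cofinite [T1Space X] {P : X → Prop} (hP : ∀ᶠ y in cofinite, P y)
    (q : X) : ∀ᶠ y in 𝓝[≠] q, P y :=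
  nhdsNE_le_cofinite q hP

theorem IsGenericUnit.eventually_continuousAt [T1Space X] {f : X → ℂ} (hf : IsGenericUnit f)
    {q : X} (hq : ContinuousAt f q) : ∀ᶠ y in 𝓝 q, ContinuousAt f y := by
  have := (eventually_nhdsNE_of_cofinite hf q).mono fun _ h => h.1
  rw [eventually_nhdsWithin_iff] at this
  filter_upwards [this] with y hy
  by_cases h : y = q
  · rwa [h]
  · exact hy h

end GenericUnit

section TotalDegree

variable {X : Type*} [TopologicalSpace X] [ChartedSpace ℂ X]

open Classical in
/-- The local degree of `f` at `q`. -/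
noncomputable def localDegree (f : X → ℂ) (q : X) : ℤ :=
  if h : ∃ k, HasLocalDegree f q k then h.choose else 0

/-- The sum of all local degrees of `f`. -/
noncomputable def totalDegree (f : X → ℂ) : ℤ := ∑ᶠ q, localDegree f q

theorem HasLocalDegree.localDegree_eq {f : X → ℂ} {q : X} {k : ℤ} (h : HasLocalDegree f q k) :
    localDegree f q = k := by
  have hex : ∃ k, HasLocalDegree f q k := ⟨k, h⟩
  rw [localDegree, dif_pos hex]
  exact hex.choose_spec.unique h

theorem IsGenericUnit.hasLocalDegree [T1Space X] {f : X → ℂ} (hf : IsGenericUnit f) (q : X) :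
    HasLocalDegree f q (localDegree f q) := by
  obtain ⟨k, hk⟩ := exists_hasLocalDegree (eventually_nhdsNE_of_cofinite hf q)
  rwa [hk.localDegree_eq]

theorem IsGenericUnit.hasLocalDegree_zero [T1Space X] {f : X → ℂ} (hf : IsGenericUnit f) {q : X}
    (hq : ContinuousAt f q ∧ f q ≠ 0) : HasLocalDegree f q 0 :=
  HasLocalDegree.of_continuousAt (hf.eventually_continuousAt hq.1) hq.2

theorem totalDegree_eq_sum {f : X → ℂ}
    {F : Finset X} (hF : ∀ q ∉ F, HasLocalDegree f q 0) :
    totalDegree f = ∑ q ∈ F, localDegree f q :=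
  finsum_eq_sum_of_support_subset _ fun q hq => by
    by_contra h
    exact hq (hF q h).localDegree_eq

theorem IsGenericUnit.finite_support [T1Space X] {f : X → ℂ} (hf : IsGenericUnit f) :
    (Function.support (localDegree f)).Finite :=
  Set.Finite.subset (s := {y | ¬ (ContinuousAt f y ∧ f y ≠ 0)}) hf fun _ hq h =>
    hq (hf.hasLocalDegree_zero h).localDegree_eq

theorem IsGenericUnit.totalDegree_mul [T1Space X] {f g : X → ℂ} (hf : IsGenericUnit f)
    (hg : IsGenericUnit g) :
    totalDegree (fun y => f y * g y) = totalDegree f + totalDegree g := by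
  rw [totalDegree, totalDegree, totalDegree,
    ← finsum_add_distrib hf.finite_support hg.finite_support]
  exact finsum_congr fun q => ((hf.hasLocalDegree q).mul (hg.hasLocalDegree q)).localDegree_eq

theorem IsGenericUnit.totalDegree_congr [T1Space X] {f g : X → ℂ} (hf : IsGenericUnit f)
    (h : f =ᶠ[cofinite] g) : totalDegree f = totalDegree g :=
  finsum_congr fun q => (((hf.hasLocalDegree q).congr (nhdsNE_le_cofinite q h)).localDegree_eq).symm

/-- The coordinate disc of radius `r` around `x`. -/
def chartDisc (x : X) (r : ℝ) : Set X := {y | y ∈ (chartAt ℂ x).source ∧ ‖centredChart x y‖ < r}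

/-- The closed coordinate disc of radius `r` around `x`. -/
def chartClosedDisc (x : X) (r : ℝ) : Set X :=
  {y | y ∈ (chartAt ℂ x).source ∧ ‖centredChart x y‖ ≤ r}

/-- The coordinate disc of radius `R` around `x` is a full disc in the coordinate. -/
def IsChartRadius (x : X) (R : ℝ) : Prop :=
  0 < R ∧ ∀ w : ℂ, ‖w‖ < R → chartAt ℂ x x + w ∈ (chartAt ℂ x).target

theorem exists_isChartRadius (x : X) : ∃ R, IsChartRadius x R := by
  obtain ⟨R, hR, h⟩ := Metric.mem_nhds_iff.1 (eventually_mem_chart_target x)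
  exact ⟨R, hR, fun w hw => h (by simpa using hw)⟩

theorem IsChartRadius.mono {x : X} {R r : ℝ} (h : IsChartRadius x R) (hr : 0 < r) (hle : r ≤ R) :
    IsChartRadius x r := ⟨hr, fun w hw => h.2 w (hw.trans_le hle)⟩

theorem chartDisc_subset (x : X) (r : ℝ) : chartDisc x r ⊆ chartClosedDisc x r :=
  fun _ h => ⟨h.1, h.2.le⟩

theorem isOpen_chartDisc (x : X) (r : ℝ) : IsOpen (chartDisc x r) :=
  ContinuousOn.isOpen_inter_preimage (f := fun y => ‖centredChart x y‖)
    (fun _ hy => (continuousAt_centredChart hy).norm.continuousWithinAt) (chartAt ℂ x).open_source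
    isOpen_Iio

theorem mem_chartDisc_self {x : X} {r : ℝ} (hr : 0 < r) : x ∈ chartDisc x r :=
  ⟨mem_chart_source ℂ x, by simpa using hr⟩

theorem IsChartRadius.centredChart_centredParam {x : X} {R : ℝ} (h : IsChartRadius x R) {w : ℂ}
    (hw : ‖w‖ < R) : centredChart x (centredParam x w) = w :=
  _root_.centredChart_centredParam (h.2 w hw)

theorem IsChartRadius.centredParam_mem_source {x : X} {R : ℝ} (h : IsChartRadius x R) {w : ℂ}
    (hw : ‖w‖ < R) : centredParam x w ∈ (chartAt ℂ x).source :=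
  (chartAt ℂ x).map_target (h.2 w hw)

theorem IsChartRadius.continuousAt_centredParam {x : X} {R : ℝ} (h : IsChartRadius x R) {w : ℂ}
    (hw : ‖w‖ < R) : ContinuousAt (centredParam x) w :=
  _root_.continuousAt_centredParam (h.2 w hw)

theorem IsChartRadius.isClosed_chartClosedDisc [T2Space X] {x : X} {R r : ℝ}
    (h : IsChartRadius x R) (hr : r < R) : IsClosed (chartClosedDisc x r) := by
  have e : chartClosedDisc x r = centredParam x '' Metric.closedBall 0 r := by
    ext y
    constructor
    · intro hy
      exact ⟨centredChart x y, by simpa using hy.2, centredParam_centredChart hy.1⟩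
    · rintro ⟨w, hw, rfl⟩
      have hw' : ‖w‖ ≤ r := by simpa using hw
      exact ⟨h.centredParam_mem_source (hw'.trans_lt hr),
        by rwa [h.centredChart_centredParam (hw'.trans_lt hr)]⟩
  rw [e]
  refine ((isCompact_closedBall 0 r).image_of_continuousOn fun w hw => ?_).isClosed
  have hw' : ‖w‖ ≤ r := by simpa using hw
  exact (h.continuousAt_centredParam (hw'.trans_lt hr)).continuousWithinAt

theorem HasLocalDegree.comp_centredParam [IsManifold 𝓘(ℂ) 1 X] {x q : X} {f : X → ℂ} {k : ℤ}
    (hf : HasLocalDegree f q k) (hq : q ∈ (chartAt ℂ x).source) :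
    HasLocalDegree (fun w => f (centredParam x w)) (_root_.centredChart x q) k := by
  have h := hf.comp_chart_symm hq
  have e : chartAt ℂ x x + _root_.centredChart x q = chartAt ℂ x q := by
    simp [_root_.centredChart]
  rw [← e] at h
  refine HasLocalDegree.comp (φ := fun w => chartAt ℂ x x + w) (c := 1) h
    (Eventually.of_forall fun w => by fun_prop) one_ne_zero ?_
  refine tendsto_const_nhds.congr' ?_
  filter_upwards [self_mem_nhdsWithin] with w hw
  simp only [centredChart_complex, add_sub_add_left_eq_sub]
  rw [div_self (sub_ne_zero.2 hw)]

/-- All singularities lie in one closed coordinate disc. Read in the coordinate and extended by 1,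
the function becomes one on the plane that is 1 near infinity, and the local degrees are unchanged.
-/
theorem totalDegree_eq_zero_of_eq_one_off_disc [T2Space X] [IsManifold 𝓘(ℂ) 1 X] {g : X → ℂ}
    (hg : IsGenericUnit g) {x : X} {r R : ℝ} (hR : IsChartRadius x R) (hr : r < R)
    (h1 : ∀ y ∉ chartDisc x r, g y = 1) : totalDegree g = 0 := by
  classical
  have hfin : {y | ¬ (ContinuousAt g y ∧ g y ≠ 0) ∧ y ∈ chartClosedDisc x r}.Finite :=
    Set.Finite.subset (s := {y | ¬ (ContinuousAt g y ∧ g y ≠ 0)}) hg fun y hy => hy.1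
  set B := hfin.toFinset with hB
  have hBmem : ∀ y, y ∈ B ↔ ¬ (ContinuousAt g y ∧ g y ≠ 0) ∧ y ∈ chartClosedDisc x r :=
    fun y => by simp [hB]
  have hout : ∀ y ∉ chartClosedDisc x r, ContinuousAt g y ∧ g y ≠ 0 := by
    intro y hy
    have : ∀ᶠ z in 𝓝 y, g z = 1 := by
      filter_upwards [(hR.isClosed_chartClosedDisc hr).isOpen_compl.mem_nhds hy] with z hz
      exact h1 z fun h => hz (chartDisc_subset x r h)
    exact ⟨continuousAt_const.congr (this.mono fun _ h => h.symm), by simp [this.self_of_nhds]⟩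
  have hzero : ∀ q ∉ B, HasLocalDegree g q 0 := by
    intro q hq
    rw [hBmem, not_and_or, not_not] at hq
    exact hg.hasLocalDegree_zero (hq.elim id (hout q))
  rw [totalDegree_eq_sum hzero]
  have hinj : Set.InjOn (centredChart x) B := fun a ha b hb hab => by
    rw [← centredParam_centredChart ((hBmem a).1 ha).2.1, hab,
      centredParam_centredChart ((hBmem b).1 hb).2.1]
  have hnear : ∀ w : ℂ, ‖w‖ < R → (fun w => if ‖w‖ < R then g (centredParam x w) else 1) =ᶠ[𝓝 w]
      fun w => g (centredParam x w) := fun w hw => by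
    filter_upwards [continuous_norm.continuousAt.eventually_lt continuousAt_const hw] with v hv
    rw [if_pos hv]
  have key := sum_localDegree_eq_zero_of_eq_one hR.1
    (fun w => localDegree g (centredParam x w)) (B.image (centredChart x)) ?_
    (g := fun w => if ‖w‖ < R then g (centredParam x w) else 1) ?_ ?_ ?_
  · rw [Finset.sum_image hinj] at key
    rw [← key]
    exact Finset.sum_congr rfl fun q hq => by
      rw [centredParam_centredChart ((hBmem q).1 hq).2.1]
  · intro q hq
    obtain ⟨y, hy, rfl⟩ := Finset.mem_image.1 hq
    exact ((hBmem y).1 hy).2.2.trans_lt hr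
  · intro w hw
    by_cases hwr : ‖w‖ ≤ r
    · have hwR := hwr.trans_lt hr
      have hgood : ContinuousAt g (centredParam x w) ∧ g (centredParam x w) ≠ 0 := by
        by_contra hbad
        refine hw (Finset.mem_image.2 ⟨centredParam x w, (hBmem _).2 ⟨hbad,
          hR.centredParam_mem_source hwR, ?_⟩, hR.centredChart_centredParam hwR⟩)
        rwa [hR.centredChart_centredParam hwR]
      refine ⟨(hgood.1.comp (hR.continuousAt_centredParam hwR)).congr (hnear w hwR).symm, ?_⟩
      simpa [if_pos hwR] using hgood.2
    · have : ∀ᶠ v in 𝓝 w, (if ‖v‖ < R then g (centredParam x v) else 1) = 1 := by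
        filter_upwards [continuousAt_const.eventually_lt continuous_norm.continuousAt
          (not_le.1 hwr)] with v hv
        split_ifs with hvR
        · refine h1 _ fun h => ?_
          have := h.2
          rw [hR.centredChart_centredParam hvR] at this
          exact lt_asymm this hv
        · rfl
      refine ⟨continuousAt_const.congr (this.mono fun _ h => h.symm), ?_⟩
      rw [this.self_of_nhds]; exact one_ne_zero
  · intro w hw
    obtain ⟨y, hy, rfl⟩ := Finset.mem_image.1 hw
    have hy' := ((hBmem y).1 hy).2
    rw [centredParam_centredChart hy'.1]
    exact ((hg.hasLocalDegree y).comp_centredParam hy'.1).congr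
      ((hnear _ (hy'.2.trans_lt hr)).symm.filter_mono nhdsWithin_le_nhds)
  · intro w hw
    rw [if_neg (not_lt.2 hw)]

/-- A function that is `1` near a closed set can be modified inside a coordinate disc so as to be
`1` near a smaller concentric disc as well, without changing its total degree. -/
theorem IsGenericUnit.exists_eq_one_on_disc [CompactSpace X] [T2Space X] [IsManifold 𝓘(ℂ) 1 X]
    {f : X → ℂ} (hf : IsGenericUnit f) {A U : Set X} (hA : IsClosed A) (hU : IsOpen U)
    (hAU : A ⊆ U) (hfU : ∀ y ∈ U, f y = 1) {x : X} {r R : ℝ}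
    (hR : IsChartRadius x R) (hrR : r < R) :
    ∃ (f' : X → ℂ) (U' : Set X), IsGenericUnit f' ∧ IsOpen U' ∧ A ∪ chartClosedDisc x r ⊆ U' ∧
      (∀ y ∈ U', f' y = 1) ∧ totalDegree f' = totalDegree f := by
  classical
  obtain ⟨V, hV, hAV, hVU⟩ := normal_exists_closure_subset hA hU hAU
  -- Only finitely many radii are excluded by bad points, so some circle between `r` and `R` meets
  -- none of them.
  obtain ⟨r', hr', hbad⟩ : ∃ r' ∈ Set.Ioo r R,
      r' ∉ (fun y => ‖centredChart x y‖) '' {y | ¬ (ContinuousAt f y ∧ f y ≠ 0)} :=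
    (Set.Ioo_infinite hrR).exists_notMem_finite (Set.Finite.image _ hf)
  have hgood : ∀ y, ‖centredChart x y‖ = r' → ContinuousAt f y ∧ f y ≠ 0 := fun y hy => by
    by_contra h
    exact hbad ⟨y, h, hy⟩
  obtain ⟨r'', hr''⟩ := exists_between hr'.1
  -- The new function is to be 1 on `K₁` (the inner disc and the part over `closure V`) and equal to
  -- `f` on the circle `K₂`. The two prescriptions are compatible because `f` is 1 over `closure V`.
  set K₁ : Set ℂ := Metric.closedBall 0 r'' ∪
    Metric.closedBall 0 r' ∩ centredParam x ⁻¹' closure V with hK₁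
  set K₂ : Set ℂ := Metric.sphere 0 r' with hK₂
  have hcl : IsClosed (Metric.closedBall 0 r' ∩ centredParam x ⁻¹' closure V) := by
    refine ContinuousOn.preimage_isClosed_of_isClosed (fun w hw => ?_) Metric.isClosed_closedBall
      isClosed_closure
    have hw' : ‖w‖ ≤ r' := by simpa using hw
    exact (hR.continuousAt_centredParam (hw'.trans_lt hr'.2)).continuousWithinAt
  have hK₁c : IsClosed K₁ := Metric.isClosed_closedBall.union hcl
  have hK₂c : IsClosed K₂ := Metric.isClosed_sphere
  have hKsub : K₁ ∪ K₂ ⊆ Metric.closedBall 0 r' := by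
    rintro w ((hw | hw) | hw)
    · exact Metric.closedBall_subset_closedBall hr''.2.le hw
    · exact hw.1
    · exact Metric.sphere_subset_closedBall hw
  have hKc : IsCompact (K₁ ∪ K₂) :=
    (isCompact_closedBall 0 r').of_isClosed_subset (hK₁c.union hK₂c) hKsub
  set φ : ℂ → ℂ := fun w => if ‖w‖ ≤ r'' then 1 else f (centredParam x w) with hφ
  have hφ₁ : ∀ w ∈ K₁, φ w = 1 := by
    rintro w (hw | hw)
    · have hw' : ‖w‖ ≤ r'' := by simpa using hw
      simp only [hφ, if_pos hw']
    · simp only [hφ]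
      split_ifs
      · rfl
      · exact hfU _ (hVU hw.2)
  have hφ₂ : ∀ w ∈ K₂, φ w = f (centredParam x w) := by
    intro w hw
    have hw' : ‖w‖ = r' := by simpa [hK₂] using hw
    have : ¬ ‖w‖ ≤ r'' := by rw [hw']; exact not_le.2 hr''.2
    simp only [hφ, if_neg this]
  have hgoodK : ∀ w ∈ K₂, ContinuousAt f (centredParam x w) ∧ f (centredParam x w) ≠ 0 := by
    intro w hw
    have hw' : ‖w‖ = r' := by simpa [hK₂] using hw
    exact hgood _ (by rw [hR.centredChart_centredParam (hw' ▸ hr'.2), hw'])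
  have hφc : ContinuousOn φ (K₁ ∪ K₂) := by
    refine ContinuousOn.union_of_isClosed (continuousOn_const.congr hφ₁)
      (ContinuousOn.congr (fun w hw => ?_) hφ₂) hK₁c hK₂c
    have hw' : ‖w‖ = r' := by simpa [hK₂] using hw
    exact ((hgoodK w hw).1.comp
      (hR.continuousAt_centredParam (hw' ▸ hr'.2))).continuousWithinAt
  have hφ0 : ∀ w ∈ K₁ ∪ K₂, φ w ≠ 0 := by
    rintro w (hw | hw)
    · rw [hφ₁ w hw]; exact one_ne_zero
    · rw [hφ₂ w hw]; exact (hgoodK w hw).2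
  obtain ⟨h, hh, hhφ, hZ⟩ := exists_extension_finite_zeros hKc hφc hφ0 r'
  set f' : X → ℂ := fun y => if y ∈ chartDisc x r' then h (centredChart x y) else f y with hf'
  have hin : ∀ y ∈ chartDisc x r', f' y = h (centredChart x y) := fun y hy => if_pos hy
  have hout : ∀ y ∉ chartDisc x r', f' y = f y := fun y hy => if_neg hy
  have hf'g : IsGenericUnit f' := by
    refine Set.Finite.subset (Set.Finite.union hf (hZ.image (centredParam x))) fun y hy => ?_
    by_contra hcon
    rw [Set.mem_union, not_or] at hcon
    have hfy : ContinuousAt f y ∧ f y ≠ 0 := not_not.1 hcon.1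
    refine hy ?_
    by_cases h1 : y ∈ chartDisc x r'
    · constructor
      · refine ContinuousAt.congr
          (hh.continuousAt.comp (continuousAt_centredChart h1.1)) ?_
        filter_upwards [(isOpen_chartDisc x r').mem_nhds h1] with z hz
        exact (hin z hz).symm
      · rw [hin y h1]
        intro h0
        exact hcon.2 ⟨centredChart x y, ⟨by simpa using h1.2.le, h0⟩,
          centredParam_centredChart h1.1⟩
    · refine ⟨?_, by rw [hout y h1]; exact hfy.2⟩
      by_cases h2 : y ∈ chartClosedDisc x r'
      · have hyn : ‖centredChart x y‖ = r' :=
          le_antisymm h2.2 (not_lt.1 fun hlt => h1 ⟨h2.1, hlt⟩)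
        have hmem : centredChart x y ∈ K₂ := by simpa [hK₂] using hyn
        -- On the bounding circle the inner and the outer formula have the same limit, so `f'` is
        -- continuous across it.
        have hval : h (centredChart x y) = f y := by
          rw [hhφ (Or.inr hmem), hφ₂ _ hmem, centredParam_centredChart h2.1]
        have t1 : Tendsto (fun z => h (centredChart x z)) (𝓝 y) (𝓝 (f y)) := by
          have := hh.continuousAt.comp (x := y) (continuousAt_centredChart h2.1)
          rw [ContinuousAt, Function.comp_apply, hval] at this
          exact this
        rw [ContinuousAt, hout y h1]
        exact t1.if' hfy.1
      · refine hfy.1.congr ?_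
        filter_upwards [(hR.isClosed_chartClosedDisc hr'.2).isOpen_compl.mem_nhds h2] with z hz
        exact (hout z fun h => hz (chartDisc_subset x r' h)).symm
  refine ⟨f', V ∪ chartDisc x r'', hf'g, hV.union (isOpen_chartDisc x r''),
    Set.union_subset_union hAV fun y hy => ⟨hy.1, hy.2.trans_lt hr''.1⟩, ?_, ?_⟩
  · intro y hy
    by_cases h1 : y ∈ chartDisc x r'
    · have hmem : centredChart x y ∈ K₁ := by
        rcases hy with hy | hy
        · refine Or.inr ⟨by simpa using h1.2.le, ?_⟩
          rw [Set.mem_preimage, centredParam_centredChart h1.1]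
          exact subset_closure hy
        · exact Or.inl (by simpa using hy.2.le)
      rw [hin y h1, hhφ (Or.inl hmem), hφ₁ _ hmem]
    · rw [hout y h1]
      rcases hy with hy | hy
      · exact hfU y (hVU (subset_closure hy))
      · exact absurd ⟨hy.1, hy.2.trans hr''.2⟩ h1
  -- Up to finitely many points `f' = f * g`, where `g` is 1 off the disc and so has total degree 0.
  · set g : X → ℂ := fun y => if y ∈ chartDisc x r' then f' y / f y else 1 with hg
    have heq : ∀ y, f y ≠ 0 → g y = f' y / f y := fun y hy => by
      by_cases h1 : y ∈ chartDisc x r'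
      · simp only [hg, if_pos h1]
      · simp only [hg, if_neg h1, hout y h1, div_self hy]
    have hgg : IsGenericUnit g := by
      filter_upwards [hf, hf'g] with y h1 h2
      refine ⟨(h2.1.div h1.1 h1.2).congr ?_, by rw [heq y h1.2]; exact div_ne_zero h2.2 h1.2⟩
      filter_upwards [h1.1.eventually_ne h1.2] with z hz
      exact (heq z hz).symm
    have hg0 : totalDegree g = 0 :=
      totalDegree_eq_zero_of_eq_one_off_disc hgg hR hr'.2 fun y hy => if_neg hy
    have e : f' =ᶠ[cofinite] fun y => f y * g y := by
      filter_upwards [hf] with y h1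
      rw [heq y h1.2, mul_div_cancel₀ _ h1.2]
    rw [hf'g.totalDegree_congr e, hf.totalDegree_mul hgg, hg0, add_zero]

/-- On a closed Riemann surface, the local degrees of a function that is continuous and nonzero
outside a finite set add up to zero. -/
theorem IsGenericUnit.totalDegree_eq_zero [CompactSpace X] [T2Space X] [IsManifold 𝓘(ℂ) 1 X]
    {f : X → ℂ} (hf : IsGenericUnit f) : totalDegree f = 0 := by
  choose R hR using exists_isChartRadius (X := X)
  have hlt : ∀ x, R x / 2 < R x := fun x => half_lt_self (hR x).1
  obtain ⟨t, -, ht⟩ := (isCompact_univ (X := X)).elim_nhds_subcover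
    (fun x => chartDisc x (R x / 2)) fun x _ =>
      (isOpen_chartDisc x _).mem_nhds (mem_chartDisc_self (half_pos (hR x).1))
  -- The discs of half the radius cover the surface. Each step keeps the value 1 near the discs
  -- already treated, so the last function is constantly 1.
  have key : ∀ t : Finset X, ∃ (f' : X → ℂ) (U : Set X), IsGenericUnit f' ∧ IsOpen U ∧
      (⋃ x ∈ t, chartClosedDisc x (R x / 2)) ⊆ U ∧ (∀ y ∈ U, f' y = 1) ∧
      totalDegree f' = totalDegree f := by
    classical
    intro t
    induction t using Finset.induction_on with
    | empty => exact ⟨f, ∅, hf, isOpen_empty, by simp, by simp, rfl⟩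
    | insert x t _ ih =>
      obtain ⟨f₁, U₁, h1, h2, h3, h4, h5⟩ := ih
      have hcl : IsClosed (⋃ x ∈ t, chartClosedDisc x (R x / 2)) :=
        t.finite_toSet.isClosed_biUnion fun x _ => (hR x).isClosed_chartClosedDisc (hlt x)
      obtain ⟨f₂, U₂, k1, k2, k3, k4, k5⟩ :=
        h1.exists_eq_one_on_disc hcl h2 h3 h4 (hR x) (hlt x)
      refine ⟨f₂, U₂, k1, k2, ?_, k4, k5.trans h5⟩
      rwa [Finset.set_biUnion_insert, Set.union_comm]
  obtain ⟨f', U, h1, -, h3, h4, h5⟩ := key t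
  have hone : ∀ y, f' y = 1 := fun y => h4 y (h3 (by
    obtain ⟨x, hx, hy⟩ := Set.mem_iUnion₂.1 (ht (Set.mem_univ y))
    exact Set.mem_iUnion₂.2 ⟨x, hx, chartDisc_subset _ _ hy⟩))
  rw [← h5, totalDegree_eq_sum (F := ∅) fun q _ => ?_, Finset.sum_empty]
  have e : f' = fun _ => 1 := funext hone
  exact h1.hasLocalDegree_zero (by rw [e]; exact ⟨continuousAt_const, one_ne_zero⟩)

end TotalDegree

/-! ### Indices of sections and the first Chern number -/

section Sections

variable {X : Type*} [TopologicalSpace X] {L : X → Type*}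
  [∀ x, TopologicalSpace (L x)] [TopologicalSpace (TotalSpace ℂ L)] [FiberBundle ℂ L]

/-- The section `s` in the preferred trivialization around `q`. -/
noncomputable def sectionCoord (s : ∀ x, L x) (q y : X) : ℂ :=
  (trivializationAt ℂ L q ⟨y, s y⟩).2

theorem eventually_mem_baseSet (L : X → Type*) [∀ x, TopologicalSpace (L x)]
    [TopologicalSpace (TotalSpace ℂ L)] [FiberBundle ℂ L] {q y : X}
    (hy : y ∈ (trivializationAt ℂ L q).baseSet) :
    ∀ᶠ z in 𝓝 y, z ∈ (trivializationAt ℂ L q).baseSet :=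
  (trivializationAt ℂ L q).open_baseSet.mem_nhds hy

theorem continuousAt_section_iff {s : ∀ x, L x} {q y : X}
    (hy : y ∈ (trivializationAt ℂ L q).baseSet) :
    ContinuousAt (fun x => TotalSpace.mk' ℂ x (s x)) y ↔ ContinuousAt (sectionCoord s q) y := by
  set e := trivializationAt ℂ L q
  have hb := eventually_mem_baseSet L hy
  rw [e.toOpenPartialHomeomorph.continuousAt_iff_continuousAt_comp_left
    (by filter_upwards [hb] with z hz; exact e.mem_source.2 hz)]
  have h : (e.toOpenPartialHomeomorph ∘ fun x => TotalSpace.mk' ℂ x (s x)) =ᶠ[𝓝 y]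
      fun z => (z, sectionCoord s q z) := by
    filter_upwards [hb] with z hz
    exact Prod.ext (e.coe_fst' hz) rfl
  rw [continuousAt_congr h]
  exact ⟨fun h => h.snd, fun h => continuousAt_id.prodMk h⟩

variable [∀ x, AddCommGroup (L x)]

/-- The section `s` is continuous at `y` and does not vanish there. -/
def IsRegularAt (s : ∀ x, L x) (y : X) : Prop :=
  ContinuousAt (fun x => TotalSpace.mk' ℂ x (s x)) y ∧ s y ≠ 0

/-- The section `s` is continuous and nonzero outside a finite set. -/
def IsGenericSection (s : ∀ x, L x) : Prop := ∀ᶠ y in cofinite, IsRegularAt s y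

variable [∀ x, Module ℂ (L x)] [VectorBundle ℂ ℂ L]

theorem sectionCoord_ne_zero_iff {s : ∀ x, L x} {q y : X}
    (hy : y ∈ (trivializationAt ℂ L q).baseSet) : sectionCoord s q y ≠ 0 ↔ s y ≠ 0 := by
  have h : sectionCoord s q y = (trivializationAt ℂ L q).continuousLinearEquivAt ℂ y hy (s y) := by
    simp [sectionCoord]
  rw [h]
  exact EmbeddingLike.map_ne_zero_iff

theorem isRegularAt_iff {s : ∀ x, L x} {q y : X}
    (hy : y ∈ (trivializationAt ℂ L q).baseSet) :
    IsRegularAt s y ↔ ContinuousAt (sectionCoord s q) y ∧ sectionCoord s q y ≠ 0 := by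
  rw [IsRegularAt, continuousAt_section_iff hy, sectionCoord_ne_zero_iff hy]

/-- Two trivializations of a line bundle differ by a factor on each fibre. -/
theorem exists_trivialization_snd_eq_mul {p q y : X}
    (hp : y ∈ (trivializationAt ℂ L p).baseSet) (hq : y ∈ (trivializationAt ℂ L q).baseSet) :
    ∃ a : ℂ, a ≠ 0 ∧ ∀ v : L y,
      (trivializationAt ℂ L p ⟨y, v⟩).2 = a * (trivializationAt ℂ L q ⟨y, v⟩).2 := by
  set A := (trivializationAt ℂ L p).continuousLinearEquivAt ℂ y hp
  set B := (trivializationAt ℂ L q).continuousLinearEquivAt ℂ y hq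
  refine ⟨A (B.symm 1), by simp, fun v => ?_⟩
  have h1 : (trivializationAt ℂ L p ⟨y, v⟩).2 = A v := by simp [A]
  have h2 : (trivializationAt ℂ L q ⟨y, v⟩).2 = B v := by simp [B]
  rw [h1, h2]
  have h3 : v = (B v) • B.symm 1 := by
    rw [← map_smul, smul_eq_mul, mul_one, B.symm_apply_apply]
  conv_lhs => rw [h3]
  rw [map_smul, smul_eq_mul, mul_comm]

/-- The quotient of two sections of a line bundle. -/
noncomputable def sectionRatio (s t : ∀ x, L x) (y : X) : ℂ :=
  sectionCoord s y y / sectionCoord t y y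

/-- A change of trivialization multiplies numerator and denominator by the same factor. Continuity
of the ratio can thus be checked in one fixed trivialization. -/
theorem sectionRatio_eq {s t : ∀ x, L x} {q y : X}
    (hy : y ∈ (trivializationAt ℂ L q).baseSet) :
    sectionRatio s t y = sectionCoord s q y / sectionCoord t q y := by
  obtain ⟨a, ha, h⟩ := exists_trivialization_snd_eq_mul
    (FiberBundle.mem_baseSet_trivializationAt ℂ L y) hy
  rw [sectionRatio, sectionCoord, sectionCoord, h, h, mul_div_mul_left _ _ ha]
  rfl

theorem isGenericUnit_sectionRatio {s t : ∀ x, L x} (hs : IsGenericSection s)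
    (ht : IsGenericSection t) : IsGenericUnit (sectionRatio s t) := by
  filter_upwards [hs, ht] with y h1 h2
  have hy := FiberBundle.mem_baseSet_trivializationAt ℂ L y
  rw [isRegularAt_iff hy] at h1 h2
  refine ⟨(h1.1.div h2.1 h2.2).congr ?_, div_ne_zero h1.2 h2.2⟩
  filter_upwards [eventually_mem_baseSet L hy] with z hz
  exact (sectionRatio_eq hz).symm

theorem IsGenericSection.eventually_sectionCoord [T1Space X] {s : ∀ x, L x}
    (hs : IsGenericSection s) (q : X) :
    ∀ᶠ y in 𝓝[≠] q, ContinuousAt (sectionCoord s q) y ∧ sectionCoord s q y ≠ 0 := by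
  filter_upwards [eventually_nhdsNE_of_cofinite hs q, nhdsWithin_le_nhds
    (eventually_mem_baseSet L (FiberBundle.mem_baseSet_trivializationAt ℂ L q))] with y h1 h2
  exact (isRegularAt_iff h2).1 h1

variable [ChartedSpace ℂ X]

/-- The index of the section `s` at `q`. -/
noncomputable def sectionDegree (s : ∀ x, L x) (q : X) : ℤ := localDegree (sectionCoord s q) q

theorem IsGenericSection.hasLocalDegree [T1Space X] {s : ∀ x, L x} (hs : IsGenericSection s)
    (q : X) : HasLocalDegree (sectionCoord s q) q (sectionDegree s q) := by
  obtain ⟨k, hk⟩ := exists_hasLocalDegree (hs.eventually_sectionCoord q)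
  rwa [sectionDegree, hk.localDegree_eq]

theorem IsGenericSection.sectionDegree_eq_zero [T1Space X] {s : ∀ x, L x}
    (hs : IsGenericSection s) {q : X} (hq : IsRegularAt s q) : sectionDegree s q = 0 := by
  rw [isRegularAt_iff (FiberBundle.mem_baseSet_trivializationAt ℂ L q)] at hq
  refine (HasLocalDegree.of_continuousAt ?_ hq.2).localDegree_eq
  have := (hs.eventually_sectionCoord q).mono fun _ h => h.1
  rw [eventually_nhdsWithin_iff] at this
  filter_upwards [this] with y hy
  by_cases h : y = q
  · rw [h]; exact hq.1
  · exact hy h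

theorem IsGenericSection.finite_support [T1Space X] {s : ∀ x, L x} (hs : IsGenericSection s) :
    (Function.support (sectionDegree s)).Finite :=
  Set.Finite.subset (s := {y | ¬ IsRegularAt s y}) hs fun _ hq h =>
    hq (hs.sectionDegree_eq_zero h)

/-- This is the bridge from winding numbers on circles to local degrees, which can be multiplied and
pulled back. -/
theorem hasIndexAt_iff [T1Space X] {s : ∀ x, L x} (hs : IsGenericSection s) {q : X} {n : ℤ} :
    HasIndexAt L s q n ↔ sectionDegree s q = n := by
  constructor
  · intro h
    exact (HasLocalDegree.of_eventually_hasWindingNumber (hs.eventually_sectionCoord q)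
      h).localDegree_eq
  · rintro rfl
    exact (hs.hasLocalDegree q).eventually_hasWindingNumber

theorem IsGenericSection.isChernNumber [T1Space X] {s : ∀ x, L x} (hs : IsGenericSection s) :
    IsChernNumber L (∑ᶠ q, sectionDegree s q) := by
  have hfin : {y | ¬ IsRegularAt s y}.Finite := hs
  have hmem : ∀ y, y ∉ hfin.toFinset → IsRegularAt s y := fun y hy => by simpa using hy
  refine ⟨hfin.toFinset, s, sectionDegree s, fun y hy => (hmem y hy).1.continuousWithinAt,
    fun y hy => (hmem y hy).2, fun q _ => (hasIndexAt_iff hs).2 rfl, ?_⟩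
  refine (finsum_eq_sum_of_support_subset _ fun q hq => ?_).symm
  by_contra h
  exact hq (hs.sectionDegree_eq_zero (hmem q h))

theorem IsChernNumber.exists_section [T1Space X] {n : ℤ} (hn : IsChernNumber L n) :
    ∃ s : ∀ x, L x, IsGenericSection s ∧ ∑ᶠ q, sectionDegree s q = n := by
  obtain ⟨F, s, k, hc, h0, hk, rfl⟩ := hn
  have hreg : ∀ y ∉ F, IsRegularAt s y := fun y hy =>
    ⟨hc.continuousAt (F.finite_toSet.isClosed.isOpen_compl.mem_nhds hy), h0 y hy⟩
  have hs : IsGenericSection s := F.finite_toSet.subset fun y hy => by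
    by_contra h
    exact hy (hreg y h)
  refine ⟨s, hs, ?_⟩
  rw [finsum_eq_sum_of_support_subset (s := F) _ fun q hq => ?_]
  · exact Finset.sum_congr rfl fun q hq => (hasIndexAt_iff hs).1 (hk q hq)
  · by_contra h
    exact hq (hs.sectionDegree_eq_zero (hreg q h))

/-- The quotient of the two sections is a function whose local degrees are the differences of the
indices, and its total degree is 0. -/
theorem finsum_sectionDegree_eq [CompactSpace X] [T2Space X] [IsManifold 𝓘(ℂ) 1 X]
    {s t : ∀ x, L x} (hs : IsGenericSection s) (ht : IsGenericSection t) :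
    ∑ᶠ q, sectionDegree s q = ∑ᶠ q, sectionDegree t q := by
  have h0 := (isGenericUnit_sectionRatio hs ht).totalDegree_eq_zero
  have h1 : ∀ q, localDegree (sectionRatio s t) q = sectionDegree s q - sectionDegree t q :=
    fun q => by
      refine HasLocalDegree.localDegree_eq
        (((hs.hasLocalDegree q).div (ht.hasLocalDegree q)).congr ?_)
      filter_upwards [nhdsWithin_le_nhds
        (eventually_mem_baseSet L (FiberBundle.mem_baseSet_trivializationAt ℂ L q))] with y hy
      exact (sectionRatio_eq hy).symm
  rw [totalDegree, finsum_congr h1, finsum_sub_distrib hs.finite_support ht.finite_support] at h0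
  exact sub_eq_zero.1 h0

/-- The first Chern number is computed by any section with finitely many zeros. -/
theorem IsGenericSection.chernNumber_eq [CompactSpace X] [T2Space X] [IsManifold 𝓘(ℂ) 1 X]
    {s : ∀ x, L x} (hs : IsGenericSection s) : chernNumber L = ∑ᶠ q, sectionDegree s q := by
  have h : ∃ n, IsChernNumber L n := ⟨_, hs.isChernNumber⟩
  rw [chernNumber, dif_pos h]
  -- The chosen Chern number comes from some unknown section `t`; independence of the section
  -- replaces `t` by `s`.
  obtain ⟨t, ht, he⟩ := h.choose_spec.exists_section
  rw [← he, finsum_sectionDegree_eq ht hs]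

end Sections

/-! ### The divisor bundle: degree and fibres -/

section DivisorBundleDegree

theorem eventually_divisor_eq_zero {X : Type*} [TopologicalSpace X] [T1Space X] (D : X →₀ ℤ) (q : X) :
    ∀ᶠ y in 𝓝[≠] q, D y = 0 :=
  nhdsNE_le_cofinite q (D.hasFiniteSupport)

variable {X : Type*} [TopologicalSpace X] [ChartedSpace ℂ X]

/-- The rational section `1` of `L_D`. -/
noncomputable def divisorSection [T2Space X] (D : X →₀ ℤ) :
    ∀ x, (divisorBundle D).Fiber x := fun _ => (1 : ℂ)

theorem sectionCoord_divisorSection [T2Space X] (D : X →₀ ℤ) (q y : X) :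
    sectionCoord (divisorSection D) q y = divisorTransition D y q y := by
  change divisorTransition D y q y * 1 = _
  rw [mul_one]

theorem sectionCoord_divisorSection_of_ne [T2Space X] {D : X →₀ ℤ} {q y : X} (hne : y ≠ q)
    (hy : D y = 0) : sectionCoord (divisorSection D) q y = centredChart q y ^ D q := by
  rw [sectionCoord_divisorSection, divisorTransition, if_neg hne]
  simp [divisorFactor, hy, centredChart]

/-- Points `y ≠ q` near `q` lie off the divisor, so their own frame is 1, and in the frame at `q`
the section 1 reads `z ^ D q`. -/
theorem hasLocalDegree_divisorSection [T2Space X] (D : X →₀ ℤ) (q : X) :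
    HasLocalDegree (sectionCoord (divisorSection D) q) q (D q) := by
  have h := (HasLocalDegree.centredChart q).zpow (D q)
  rw [one_mul] at h
  refine h.congr ?_
  filter_upwards [eventually_divisor_eq_zero D q, self_mem_nhdsWithin] with y hy hne
  exact (sectionCoord_divisorSection_of_ne hne hy).symm

theorem isGenericSection_divisorSection [T2Space X] (D : X →₀ ℤ) :
    IsGenericSection (divisorSection D) := by
  refine D.hasFiniteSupport.subset fun y hy => ?_
  by_contra h
  have h0 : D y = 0 := by simpa using h
  refine hy ⟨?_, one_ne_zero (α := ℂ)⟩
  rw [continuousAt_section_iff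
    (FiberBundle.mem_baseSet_trivializationAt ℂ (divisorBundle D).Fiber y)]
  refine (continuousAt_const (y := (1 : ℂ))).congr ?_
  have := eventually_divisor_eq_zero D y
  rw [eventually_nhdsWithin_iff] at this
  filter_upwards [this] with z hz
  by_cases hzy : z = y
  · rw [hzy, sectionCoord_divisorSection, divisorTransition, if_pos rfl]
  · rw [sectionCoord_divisorSection_of_ne hzy (hz hzy), h0, zpow_zero]

theorem chernNumber_divisorBundle [CompactSpace X] [T2Space X] [IsManifold 𝓘(ℂ) 1 X]
    (D : X →₀ ℤ) : chernNumber (divisorBundle D).Fiber = D.sum fun _ d => d := by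
  rw [(isGenericSection_divisorSection D).chernNumber_eq,
    finsum_congr (f := sectionDegree (divisorSection D))
      fun q => (hasLocalDegree_divisorSection D q).localDegree_eq]
  exact finsum_eq_sum_of_support_subset _ fun q hq => by simpa using hq

theorem fibreIsoTangentPower_divisorBundle {G : Type*} [Group G] [MulAction G X] [T2Space X]
    (hG : IsHolomorphicAction G X) (D : X →₀ ℤ) (hD : ↑D.support ⊆ MulAction.fixedPoints G X)
    {x : X} (hx : x ∈ MulAction.fixedPoints G X) :
    (divisorEquivariantStructure hG D hD).FibreIsoTangentPower x (D x) := by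
  refine ⟨LinearEquiv.refl ℂ ℂ, fun g v => ?_⟩
  change ℂ at v
  change TotalSpace.mk (F := ℂ) (E := fun _ : X => ℂ) (g • x) (tangentWeight g x ^ D x * v) =
    TotalSpace.mk x (tangentWeight g x ^ D x * v)
  rw [hx g]

end DivisorBundleDegree

/-! ### Local degree under the group action -/

section Holomorphic

variable {G X : Type*} [Group G] [MulAction G X] [TopologicalSpace X] [ChartedSpace ℂ X]

theorem IsHolomorphicAction.continuous_smul (hG : IsHolomorphicAction G X) (g : G) :
    Continuous fun x : X => g • x := (hG g).continuous

/-- Unlike `tendsto_tangentWeight`, this does not ask that `x` be fixed: indices are to be compared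
along free orbits as well. -/
theorem IsHolomorphicAction.tendsto_centredChart_div (hG : IsHolomorphicAction G X) (g : G)
    (x : X) : Tendsto (fun y => centredChart (g • x) (g • y) / centredChart x y) (𝓝[≠] x)
      (𝓝 (tangentWeight g x)) := by
  have hder : HasDerivAt (fun z => chartAt ℂ (g • x) (g • (chartAt ℂ x).symm z))
      (tangentWeight g x) (chartAt ℂ x x) := by
    have h1 : HasFDerivWithinAt (writtenInExtChartAt 𝓘(ℂ) 𝓘(ℂ) x (fun y => g • y))
        (tangentMapAt g x) (Set.range 𝓘(ℂ)) (extChartAt 𝓘(ℂ) x x) := (hG g x).hasMFDerivAt.2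
    have e : writtenInExtChartAt 𝓘(ℂ) 𝓘(ℂ) x (fun y => g • y) =
        fun z => chartAt ℂ (g • x) (g • (chartAt ℂ x).symm z) := by
      funext z
      simp [writtenInExtChartAt]
    rw [e] at h1
    simp only [modelWithCornersSelf_coe, Set.range_id, hasFDerivWithinAt_univ] at h1
    exact h1.hasDerivAt
  rw [hasDerivAt_iff_tendsto_slope] at hder
  have hmap : Tendsto (chartAt ℂ x) (𝓝[≠] x) (𝓝[≠] (chartAt ℂ x x)) := by
    refine tendsto_nhdsWithin_iff.2
      ⟨((chartAt ℂ x).continuousAt (mem_chart_source ℂ x)).tendsto.mono_left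
        nhdsWithin_le_nhds, ?_⟩
    filter_upwards [eventually_centredChart_ne_zero x] with y hy h
    exact hy (sub_eq_zero.2 h)
  refine (hder.comp hmap).congr' ?_
  filter_upwards [nhdsWithin_le_nhds (eventually_mem_chart_source x)] with y hy
  simp [slope, centredChart, (chartAt ℂ x).left_inv hy,
    (chartAt ℂ x).left_inv (mem_chart_source ℂ x), div_eq_inv_mul]

theorem HasLocalDegree.comp_smul (hG : IsHolomorphicAction G X) {f : X → ℂ} {g : G} {q : X} {k : ℤ}
    (hf : HasLocalDegree f (g • q) k) : HasLocalDegree (fun y => f (g • y)) q k :=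
  HasLocalDegree.comp (φ := fun y => g • y) hf
    (Eventually.of_forall fun _ => (hG.continuous_smul g).continuousAt)
    (tangentWeight_ne_zero hG g q) (hG.tendsto_centredChart_div g q)

end Holomorphic

theorem eventually_smul_mem_baseSet {G X : Type*} [Group G] [MulAction G X] [TopologicalSpace X]
    {L : X → Type*} [∀ x, TopologicalSpace (L x)] [TopologicalSpace (TotalSpace ℂ L)]
    [FiberBundle ℂ L] (hc : ∀ g : G, Continuous fun x : X => g • x) (g : G)
    (q : X) :
    ∀ᶠ y in 𝓝 q, g • y ∈ (trivializationAt ℂ L (g • q)).baseSet :=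
  (hc g).continuousAt.eventually
    (eventually_mem_baseSet L (FiberBundle.mem_baseSet_trivializationAt ℂ L (g • q)))

/-! ### Translates, averages and equivariant sections -/

namespace EquivariantStructure

section Algebra

variable {G X : Type*} [Group G] [MulAction G X] {L : X → Type*} [∀ x, AddCommGroup (L x)]
  [∀ x, Module ℂ (L x)] [TopologicalSpace (TotalSpace ℂ L)] (ρ : EquivariantStructure G L)

/-- The action of `g` from the fibre over `x` to the fibre over `g • x`. -/
noncomputable def fibreMap (g : G) (x : X) : L x →ₗ[ℂ] L (g • x) := (ρ.linear_act g x).choose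

theorem act_mk (g : G) (x : X) (v : L x) : ρ.act g ⟨x, v⟩ = ⟨g • x, ρ.fibreMap g x v⟩ :=
  (ρ.linear_act g x).choose_spec v

theorem act_injective (g : G) : Function.Injective (ρ.act g) := fun v w h => by
  have := congrArg (ρ.act g⁻¹) h
  rwa [← ρ.act_mul, ← ρ.act_mul, inv_mul_cancel, ρ.act_one, ρ.act_one] at this

theorem fibreMap_eq_zero_iff {g : G} {x : X} {v : L x} : ρ.fibreMap g x v = 0 ↔ v = 0 := by
  refine ⟨fun h => ?_, fun h => by rw [h, map_zero]⟩
  have h1 : ρ.act g ⟨x, v⟩ = ρ.act g ⟨x, 0⟩ := by rw [act_mk, act_mk, h, map_zero]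
  exact TotalSpace.mk_inj.1 (ρ.act_injective g h1)

/-- The section `s` is equivariant. -/
def IsEquivariant (s : ∀ x, L x) : Prop := ∀ g x, ρ.act g ⟨x, s x⟩ = ⟨g • x, s (g • x)⟩

theorem IsEquivariant.fibreMap_eq {ρ : EquivariantStructure G L} {s : ∀ x, L x}
    (hs : ρ.IsEquivariant s) (g : G) (x : X) : ρ.fibreMap g x (s x) = s (g • x) := by
  have := hs g x
  rw [act_mk] at this
  exact TotalSpace.mk_inj.1 this

theorem isEquivariant_zero : ρ.IsEquivariant fun _ => 0 := fun g x => by rw [act_mk, map_zero]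

theorem exists_translate (g : G) (σ : ∀ x, L x) (y : X) :
    ∃ v : L y, (⟨y, v⟩ : TotalSpace ℂ L) = ρ.act g ⟨g⁻¹ • y, σ (g⁻¹ • y)⟩ := by
  rw [act_mk]
  -- The fibres over `g • g⁻¹ • y` and over `y` coincide only through an equation of base points,
  -- along which the vector is carried.
  generalize ρ.fibreMap g (g⁻¹ • y) (σ (g⁻¹ • y)) = w
  have h : g • g⁻¹ • y = y := smul_inv_smul g y
  generalize g • g⁻¹ • y = z at w h
  subst h
  exact ⟨w, rfl⟩

/-- The section `g ∘ σ ∘ g⁻¹`. -/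
noncomputable def translate (g : G) (σ : ∀ x, L x) (y : X) : L y :=
  (ρ.exists_translate g σ y).choose

theorem mk_translate (g : G) (σ : ∀ x, L x) (y : X) :
    (⟨y, ρ.translate g σ y⟩ : TotalSpace ℂ L) = ρ.act g ⟨g⁻¹ • y, σ (g⁻¹ • y)⟩ :=
  (ρ.exists_translate g σ y).choose_spec

theorem translate_eq_zero {g : G} {σ : ∀ x, L x} {y : X} (h : σ (g⁻¹ • y) = 0) :
    ρ.translate g σ y = 0 := by
  have h1 := ρ.mk_translate g σ y
  rw [h, act_mk, map_zero] at h1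
  have h2 : (⟨g • g⁻¹ • y, 0⟩ : TotalSpace ℂ L) = ⟨y, 0⟩ := by rw [smul_inv_smul]
  exact TotalSpace.mk_inj.1 (h1.trans h2)

theorem translate_one (σ : ∀ x, L x) (y : X) : ρ.translate 1 σ y = σ y := by
  have h1 := ρ.mk_translate 1 σ y
  rw [ρ.act_one] at h1
  have h2 : (⟨(1 : G)⁻¹ • y, σ ((1 : G)⁻¹ • y)⟩ : TotalSpace ℂ L) = ⟨y, σ y⟩ := by
    rw [inv_one, one_smul]
  exact TotalSpace.mk_inj.1 (h1.trans h2)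

theorem fibreMap_translate (h g : G) (σ : ∀ x, L x) (y : X) :
    ρ.fibreMap h y (ρ.translate g σ y) = ρ.translate (h * g) σ (h • y) := by
  suffices e : (⟨h • y, ρ.fibreMap h y (ρ.translate g σ y)⟩ : TotalSpace ℂ L) =
      ⟨h • y, ρ.translate (h * g) σ (h • y)⟩ from TotalSpace.mk_inj.1 e
  rw [← act_mk, mk_translate, mk_translate, ρ.act_mul, mul_inv_rev, mul_smul, inv_smul_smul]

variable [Fintype G]

/-- The sum of the translates of a section. -/
noncomputable def average (σ : ∀ x, L x) (y : X) : L y := ∑ g : G, ρ.translate g σ y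

theorem isEquivariant_average (σ : ∀ x, L x) : ρ.IsEquivariant (ρ.average σ) := fun h y => by
  rw [act_mk, average, average, map_sum]
  congr 1
  simp only [fibreMap_translate]
  exact Equiv.sum_comp (Equiv.mulLeft h) fun g => ρ.translate g σ (h • y)

/-- Intended for a section supported in a set disjoint from its translates: averaging spreads it
over the orbit without altering it on that set. -/
theorem average_eq_self {σ : ∀ x, L x} {y : X} (h : ∀ g : G, g ≠ 1 → σ (g • y) = 0) :
    ρ.average σ y = σ y := by
  rw [average, Finset.sum_eq_single 1, translate_one]
  · exact fun g _ hg => ρ.translate_eq_zero (h _ (inv_ne_one.2 hg))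
  · simp

end Algebra

section Coordinates

variable {G X : Type*} [Group G] [MulAction G X] [TopologicalSpace X] {L : X → Type*}
  [∀ x, AddCommGroup (L x)] [∀ x, Module ℂ (L x)] [TopologicalSpace (TotalSpace ℂ L)]
  {ρ : EquivariantStructure G L}

theorem IsEquivariant.isRegularAt_smul {s : ∀ x, L x} (hs : ρ.IsEquivariant s)
    (hc : ∀ g : G, Continuous fun x : X => g • x) {y : X} (hy : IsRegularAt s y) (g : G) :
    IsRegularAt s (g • y) := by
  refine ⟨?_, ?_⟩
  · have e : (fun x => TotalSpace.mk' ℂ x (s x)) =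
        fun x => ρ.act g (TotalSpace.mk' ℂ (g⁻¹ • x) (s (g⁻¹ • x))) := by
      funext x
      rw [TotalSpace.mk', TotalSpace.mk', hs, smul_inv_smul]
    rw [e]
    have h1 : ContinuousAt (fun x => TotalSpace.mk' ℂ x (s x)) (g⁻¹ • g • y) := by
      rw [inv_smul_smul]; exact hy.1
    exact (ρ.continuous_act g).continuousAt.comp
      (h1.comp (f := fun x => g⁻¹ • x) (hc g⁻¹).continuousAt)
  · rw [← hs.fibreMap_eq]
    exact fun h => hy.2 (ρ.fibreMap_eq_zero_iff.1 h)

theorem IsEquivariant.isRegularAt_smul_iff {s : ∀ x, L x} (hs : ρ.IsEquivariant s)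
    (hc : ∀ g : G, Continuous fun x : X => g • x) {y : X} {g : G} :
    IsRegularAt s (g • y) ↔ IsRegularAt s y :=
  ⟨fun h => by simpa using hs.isRegularAt_smul hc h g⁻¹, fun h => hs.isRegularAt_smul hc h g⟩

variable [∀ x, TopologicalSpace (L x)] [FiberBundle ℂ L] [VectorBundle ℂ ℂ L]

/-- The local frame of `L` given by the preferred trivialization around `q`. -/
noncomputable def _root_.localFrame (L : X → Type*) [∀ x, AddCommGroup (L x)]
    [∀ x, Module ℂ (L x)] [∀ x, TopologicalSpace (L x)] [TopologicalSpace (TotalSpace ℂ L)]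
    [FiberBundle ℂ L] [VectorBundle ℂ ℂ L] (q y : X) : L y :=
  (trivializationAt ℂ L q).symm y 1

theorem _root_.trivializationAt_localFrame {q y : X}
    (hy : y ∈ (trivializationAt ℂ L q).baseSet) :
    (trivializationAt ℂ L q ⟨y, localFrame L q y⟩).2 = 1 := by
  rw [localFrame, Trivialization.mk_symm _ hy]
  exact congrArg Prod.snd ((trivializationAt ℂ L q).apply_symm_apply
    ((trivializationAt ℂ L q).mem_target.2 hy))

theorem _root_.trivializationAt_smul {q y : X} (hy : y ∈ (trivializationAt ℂ L q).baseSet)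
    (c : ℂ) (v : L y) : (trivializationAt ℂ L q ⟨y, c • v⟩).2 =
      c * (trivializationAt ℂ L q ⟨y, v⟩).2 :=
  ((trivializationAt ℂ L q).linear ℂ hy).map_smul c v

theorem _root_.trivializationAt_sum {ι : Type*} (I : Finset ι) {q y : X}
    (hy : y ∈ (trivializationAt ℂ L q).baseSet) (v : ι → L y) :
    (trivializationAt ℂ L q ⟨y, ∑ i ∈ I, v i⟩).2 =
      ∑ i ∈ I, (trivializationAt ℂ L q ⟨y, v i⟩).2 :=
  map_sum (((trivializationAt ℂ L q).linear ℂ hy).mk' _) v I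

theorem _root_.eq_smul_localFrame {q y : X} (hy : y ∈ (trivializationAt ℂ L q).baseSet)
    (v : L y) : v = (trivializationAt ℂ L q ⟨y, v⟩).2 • localFrame L q y := by
  have hinj : Function.Injective fun v : L y => (trivializationAt ℂ L q ⟨y, v⟩).2 := by
    have := ((trivializationAt ℂ L q).continuousLinearEquivAt ℂ y hy).injective
    convert this using 1
    funext v
    simp
  apply hinj
  simp only
  rw [trivializationAt_smul hy, trivializationAt_localFrame hy, mul_one]

variable (ρ) in
/-- The action of `g` from the fibre over `y` to the fibre over `g • y`, in the preferred
trivializations around `q` and `g • q`. -/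
noncomputable def actCoord (g : G) (q y : X) : ℂ :=
  (trivializationAt ℂ L (g • q) (ρ.act g ⟨y, localFrame L q y⟩)).2

theorem trivializationAt_act {g : G} {q y : X} (hy : y ∈ (trivializationAt ℂ L q).baseSet)
    (hgy : g • y ∈ (trivializationAt ℂ L (g • q)).baseSet) (v : L y) :
    (trivializationAt ℂ L (g • q) (ρ.act g ⟨y, v⟩)).2 =
      ρ.actCoord g q y * (trivializationAt ℂ L q ⟨y, v⟩).2 := by
  conv_lhs => rw [eq_smul_localFrame hy v]
  rw [act_mk, map_smul, trivializationAt_smul hgy, actCoord, act_mk, mul_comm]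

theorem actCoord_ne_zero {g : G} {q y : X} (hy : y ∈ (trivializationAt ℂ L q).baseSet)
    (hgy : g • y ∈ (trivializationAt ℂ L (g • q)).baseSet) : ρ.actCoord g q y ≠ 0 := by
  have h0 : localFrame L q y ≠ 0 := fun h => by
    have := trivializationAt_localFrame hy
    have h2 := trivializationAt_smul hy 0 (localFrame L q y)
    rw [zero_smul, zero_mul] at h2
    rw [h, h2] at this
    exact zero_ne_one this
  rw [actCoord, act_mk]
  intro h
  have h1 := eq_smul_localFrame hgy (ρ.fibreMap g y (localFrame L q y))
  rw [h, zero_smul] at h1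
  exact h0 (ρ.fibreMap_eq_zero_iff.1 h1)

theorem eventually_continuousAt_actCoord (hc : ∀ g : G, Continuous fun x : X => g • x) (g : G)
    (q : X) : ∀ᶠ y in 𝓝 q, ContinuousAt (ρ.actCoord g q) y := by
  filter_upwards [eventually_smul_mem_baseSet (L := L) hc g q,
    eventually_mem_baseSet L (FiberBundle.mem_baseSet_trivializationAt ℂ L q)] with y hgy hy
  have h1 : ContinuousAt (fun x => TotalSpace.mk' ℂ x (localFrame L q x)) y := by
    rw [continuousAt_section_iff hy]
    refine (continuousAt_const (y := (1 : ℂ))).congr ?_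
    filter_upwards [eventually_mem_baseSet L hy] with z hz
    exact (trivializationAt_localFrame hz).symm
  have h2 := (ρ.continuous_act g).continuousAt.comp h1
  have h3 : ContinuousAt (trivializationAt ℂ L (g • q)) (ρ.act g ⟨y, localFrame L q y⟩) :=
    (trivializationAt ℂ L (g • q)).continuousAt
      ((trivializationAt ℂ L (g • q)).mem_source.2 (by rw [act_mk]; exact hgy))
  exact (ContinuousAt.comp (f := fun x => ρ.act g ⟨x, localFrame L q x⟩) h3 h2).snd

variable [ChartedSpace ℂ X]

theorem hasLocalDegree_actCoord (hc : ∀ g : G, Continuous fun x : X => g • x) (g : G) (q : X) :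
    HasLocalDegree (ρ.actCoord g q) q 0 :=
  HasLocalDegree.of_continuousAt (eventually_continuousAt_actCoord hc g q)
    (actCoord_ne_zero (FiberBundle.mem_baseSet_trivializationAt ℂ L q)
      (FiberBundle.mem_baseSet_trivializationAt ℂ L (g • q)))

/-- An equivariant section has the same index at all points of an orbit. -/
theorem IsEquivariant.sectionDegree_smul [T1Space X] (hG : IsHolomorphicAction G X)
    {s : ∀ x, L x} (hs : ρ.IsEquivariant s) (hgen : IsGenericSection s) (g : G) (q : X) :
    sectionDegree s (g • q) = sectionDegree s q := by
  -- Pullback by the holomorphic map `g` preserves the degree. By equivariance the coordinates of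
  -- `s` at `g • y` and at `y` differ by `actCoord`, which is continuous and nonzero and so has
  -- degree 0.
  have h1 := ((hgen.hasLocalDegree (g • q)).comp_smul hG)
  have h2 := h1.div (hasLocalDegree_actCoord (ρ := ρ) hG.continuous_smul g q)
  rw [sub_zero] at h2
  refine (HasLocalDegree.localDegree_eq (h2.congr ?_)).symm
  filter_upwards [nhdsWithin_le_nhds (eventually_smul_mem_baseSet (L := L) hG.continuous_smul g q),
    nhdsWithin_le_nhds (eventually_mem_baseSet L
      (FiberBundle.mem_baseSet_trivializationAt ℂ L q))] with y hgy hy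
  rw [div_eq_iff (actCoord_ne_zero hy hgy), sectionCoord, ← hs, trivializationAt_act hy hgy,
    mul_comm]
  rfl

/-- Near a fixed point at which the representation on the fibre is the `d`-th power of the
tangent representation, there is an equivariant section of index `d`. -/
theorem exists_equivariant_section_at_fixedPoint [Fintype G] [T1Space X] (hG : IsHolomorphicAction G X) {x : X}
    (hx : x ∈ MulAction.fixedPoints G X) {d : ℤ} (hd : ρ.FibreIsoTangentPower x d) :
    ∃ s : ∀ y, L y, ρ.IsEquivariant s ∧ (∀ᶠ y in 𝓝[≠] x, IsRegularAt s y) ∧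
      HasLocalDegree (sectionCoord s x) x d := by
  have hxb := FiberBundle.mem_baseSet_trivializationAt ℂ L x
  have hact : ∀ g : G, ρ.actCoord g x x = tangentWeight g x ^ d := by
    intro g
    obtain ⟨e, he⟩ := hd
    have h1 : ρ.act g ⟨x, localFrame L x x⟩ = ⟨x, (tangentWeight g x ^ d) • localFrame L x x⟩ := by
      rw [he, ← smul_eq_mul, map_smul, e.symm_apply_apply]
    rw [actCoord, h1, hx g, trivializationAt_smul hxb, trivializationAt_localFrame hxb, mul_one]
  -- The model section of index `d` at `x`; averaging makes it equivariant, and the hypothesis on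
  -- the fibre prevents its leading term from cancelling.
  set σ : ∀ y, L y := fun y => (centredChart x y ^ d) • localFrame L x y with hσ
  set s := ρ.average σ with hs
  have hsmul : ∀ g : G, Tendsto (fun y : X => g • y) (𝓝[≠] x) (𝓝[≠] x) := fun g => by
    refine tendsto_nhdsWithin_iff.2 ⟨?_, ?_⟩
    · have := (hG.continuous_smul g).continuousAt (x := x)
      rw [ContinuousAt, hx g] at this
      exact this.mono_left nhdsWithin_le_nhds
    · filter_upwards [self_mem_nhdsWithin] with y hy h
      exact hy (smul_left_cancel g (h.trans (hx g).symm))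
  have hbase : ∀ᶠ y in 𝓝[≠] x, y ∈ (trivializationAt ℂ L x).baseSet :=
    nhdsWithin_le_nhds (eventually_mem_baseSet L hxb)
  set T : X → ℂ := fun y => ∑ g : G, ρ.actCoord g x (g⁻¹ • y) * centredChart x (g⁻¹ • y) ^ d
    with hT
  have hcoord : sectionCoord s x =ᶠ[𝓝[≠] x] T := by
    have hall : ∀ᶠ y in 𝓝[≠] x, ∀ g : G, g⁻¹ • y ∈ (trivializationAt ℂ L x).baseSet :=
      eventually_all.2 fun g => (hsmul g⁻¹).eventually hbase
    filter_upwards [hbase, hall] with y hy hy'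
    rw [sectionCoord, hs, average, trivializationAt_sum _ hy]
    refine Finset.sum_congr rfl fun g _ => ?_
    have hgy : g • g⁻¹ • y ∈ (trivializationAt ℂ L (g • x)).baseSet := by
      rw [smul_inv_smul, hx g]; exact hy
    have := trivializationAt_act (ρ := ρ) (hy' g) hgy (σ (g⁻¹ • y))
    rw [mk_translate]
    rw [hx g] at this
    rw [this, hσ, trivializationAt_smul (hy' g), trivializationAt_localFrame (hy' g), mul_one]
  have hTc : ∀ᶠ y in 𝓝[≠] x, ContinuousAt T y := by
    have hall : ∀ᶠ y in 𝓝[≠] x, ∀ g : G, ContinuousAt (ρ.actCoord g x) (g⁻¹ • y) ∧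
        ContinuousAt (centredChart x) (g⁻¹ • y) ∧ centredChart x (g⁻¹ • y) ≠ 0 :=
      eventually_all.2 fun g => (hsmul g⁻¹).eventually
        (((eventually_continuousAt_actCoord hG.continuous_smul g x).filter_mono
          nhdsWithin_le_nhds).and (((eventually_continuousAt_centredChart x).filter_mono
          nhdsWithin_le_nhds).and (eventually_centredChart_ne_zero x)))
    filter_upwards [hall] with y hy
    refine tendsto_finsetSum _ fun g _ => ?_
    have hg := (hG.continuous_smul g⁻¹).continuousAt (x := y)
    exact ((hy g).1.comp (f := fun y => g⁻¹ • y) hg).mul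
      ((((hy g).2.1.comp (f := fun y => g⁻¹ • y) hg)).zpow₀ d (Or.inl (hy g).2.2))
  have hlim : Tendsto (fun y => T y / centredChart x y ^ d) (𝓝[≠] x)
      (𝓝 (Fintype.card G : ℂ)) := by
    -- The fibre contributes the weight of `g` to the power `d`, and the coordinate that of `g⁻¹`.
    -- The product is 1, so the limits of the summands add up to the order of `G`.
    have hterm : ∀ g : G, Tendsto (fun y => ρ.actCoord g x (g⁻¹ • y) *
        (centredChart x (g⁻¹ • y) / centredChart x y) ^ d) (𝓝[≠] x) (𝓝 1) := by
      intro g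
      have h1 : Tendsto (fun y => ρ.actCoord g x (g⁻¹ • y)) (𝓝[≠] x)
          (𝓝 (tangentWeight g x ^ d)) := by
        have := (eventually_continuousAt_actCoord (ρ := ρ) hG.continuous_smul g x).self_of_nhds
        rw [ContinuousAt, hact g] at this
        exact this.comp ((hsmul g⁻¹).mono_right nhdsWithin_le_nhds)
      have h2 := (hG.tendsto_centredChart_div g⁻¹ x).zpow₀ d
        (Or.inl (tangentWeight_ne_zero hG g⁻¹ x))
      rw [hx g⁻¹] at h2
      have h3 : tangentWeight g x ^ d * tangentWeight g⁻¹ x ^ d = 1 := by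
        have := tangentWeight_mul hG g g⁻¹ x
        rw [mul_inv_cancel, tangentWeight_one, hx g⁻¹] at this
        rw [← mul_zpow, ← this, one_zpow]
      rw [← h3]
      exact h1.mul h2
    have hsum := tendsto_finsetSum Finset.univ fun g _ => hterm g
    simp only [Finset.sum_const, Finset.card_univ, nsmul_eq_mul, mul_one] at hsum
    refine hsum.congr fun y => ?_
    rw [hT, Finset.sum_div]
    exact Finset.sum_congr rfl fun g _ => by rw [div_zpow, mul_div_assoc]
  have hcard : (Fintype.card G : ℂ) ≠ 0 := by exact_mod_cast Fintype.card_ne_zero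
  have hdeg : HasLocalDegree T x d := by
    have h1 : HasLocalDegree (fun y => T y / centredChart x y ^ d) x 0 := by
      refine HasLocalDegree.of_tendsto hcard ?_ hlim
      filter_upwards [hTc, eventually_centredChart_ne_zero x,
        nhdsWithin_le_nhds (eventually_continuousAt_centredChart x)] with y h1 h2 h3
      exact h1.div (h3.zpow₀ d (Or.inl h2)) (zpow_ne_zero _ h2)
    have h2 := h1.mul ((HasLocalDegree.centredChart x).zpow d)
    rw [one_mul, zero_add] at h2
    refine h2.congr ?_
    filter_upwards [eventually_centredChart_ne_zero x] with y hy
    exact div_mul_cancel₀ _ (zpow_ne_zero _ hy)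
  refine ⟨s, ρ.isEquivariant_average σ, ?_, hdeg.congr hcoord.symm⟩
  have hne : ∀ᶠ y in 𝓝[≠] x, T y ≠ 0 := by
    filter_upwards [hlim.eventually_ne hcard] with y hy h0
    simp [h0] at hy
  -- Continuity at `y ≠ x` requires the two functions to agree on a whole neighbourhood of `y`, not
  -- only at `y`.
  filter_upwards [eventually_eventually_nhdsWithin.2 hcoord, hcoord, hTc, hne, hbase,
    self_mem_nhdsWithin] with y h1 h2 h3 h4 h5 h6
  have h7 : sectionCoord s x =ᶠ[𝓝 y] T := by
    rwa [IsOpen.nhdsWithin_eq isOpen_compl_singleton h6] at h1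
  rw [isRegularAt_iff h5]
  exact ⟨h3.congr h7.symm, by rwa [h2]⟩

end Coordinates

end EquivariantStructure

/-! ### Extending equivariant sections -/

theorem isOpen_forall_smul_mem {G X : Type*} [Group G] [Finite G] [MulAction G X]
    [TopologicalSpace X] (hc : ∀ g : G, Continuous fun x : X => g • x) {S : Set X}
    (hS : IsOpen S) : IsOpen {y : X | ∀ g : G, g • y ∈ S} := by
  rw [Set.ofPred_forall]
  exact isOpen_iInter_of_finite fun g => hS.preimage (hc g)

theorem forall_smul_smul_mem_iff {G X : Type*} [Group G] [MulAction G X] {S : Set X} (h : G)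
    {y : X} : h • y ∈ {y : X | ∀ g : G, g • y ∈ S} ↔ y ∈ {y : X | ∀ g : G, g • y ∈ S} := by
  simp only [Set.mem_ofPred_eq, smul_smul]
  exact ⟨fun H g => by simpa using H (g * h⁻¹), fun H g => H (g * h)⟩

section Regular

variable {X : Type*} [TopologicalSpace X] {L : X → Type*} [TopologicalSpace (TotalSpace ℂ L)]

theorem isRegularAt_congr [∀ x, AddCommGroup (L x)] {s t : ∀ x, L x} {y : X} (h : ∀ᶠ z in 𝓝 y, s z = t z) :
    IsRegularAt s y ↔ IsRegularAt t y := by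
  have e : (fun x => TotalSpace.mk' ℂ x (s x)) =ᶠ[𝓝 y] fun x => TotalSpace.mk' ℂ x (t x) :=
    h.mono fun z hz => by simp only [hz]
  rw [IsRegularAt, IsRegularAt, continuousAt_congr e, h.self_of_nhds]

theorem sectionCoord_congr [∀ x, TopologicalSpace (L x)] [FiberBundle ℂ L] {s t : ∀ x, L x}
    (q : X) {y : X} (h : ∀ᶠ z in 𝓝 y, s z = t z) : sectionCoord s q =ᶠ[𝓝 y] sectionCoord t q :=
  h.mono fun z hz => by simp only [sectionCoord, hz]

end Regular

namespace EquivariantStructure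

variable {G X : Type*} [Group G] [MulAction G X] [TopologicalSpace X]
  [ChartedSpace ℂ X] {L : X → Type*}
  [∀ x, AddCommGroup (L x)] [∀ x, Module ℂ (L x)] [∀ x, TopologicalSpace (L x)]
  [TopologicalSpace (TotalSpace ℂ L)] [FiberBundle ℂ L] {ρ : EquivariantStructure G L}
  {d : X → ℤ}

variable (ρ d) in
/-- There is an equivariant section that, on an invariant neighbourhood of `A`, is regular outside
a finite set, and has index `d x` at the fixed points `x` in `A`. -/
def HasRegularSectionNear (A : Set X) : Prop :=
  ∃ (U : Set X) (s : ∀ x, L x), IsOpen U ∧ A ⊆ U ∧ (∀ (g : G), ∀ y ∈ U, g • y ∈ U) ∧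
    ρ.IsEquivariant s ∧ {y ∈ U | ¬ IsRegularAt s y}.Finite ∧
    ∀ x ∈ A, x ∈ MulAction.fixedPoints G X → HasLocalDegree (sectionCoord s x) x (d x)

theorem hasRegularSectionNear_empty : ρ.HasRegularSectionNear d ∅ :=
  ⟨∅, fun _ => 0, isOpen_empty, subset_rfl, by simp, ρ.isEquivariant_zero, by simp, by simp⟩

/-- The irregular points in `U` form a finite invariant set. Deleting those outside the invariant
set `A` leaves an open invariant neighbourhood of `A`. -/
theorem HasRegularSectionNear.shrink [T1Space X] {A : Set X} (h : ρ.HasRegularSectionNear d A)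
    (hA : ∀ (g : G), ∀ y ∈ A, g • y ∈ A) (hc : ∀ g : G, Continuous fun x : X => g • x) :
    ∃ (U : Set X) (s : ∀ x, L x), IsOpen U ∧ A ⊆ U ∧ (∀ (g : G), ∀ y ∈ U, g • y ∈ U) ∧
    ρ.IsEquivariant s ∧ {y ∈ U | ¬ IsRegularAt s y}.Finite ∧
    {y ∈ U | ¬ IsRegularAt s y} ⊆ A ∧
    ∀ x ∈ A, x ∈ MulAction.fixedPoints G X → HasLocalDegree (sectionCoord s x) x (d x) := by
  obtain ⟨U, s, hU, hAU, hUG, hs, hfin, hdeg⟩ := h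
  refine ⟨U \ ({y ∈ U | ¬ IsRegularAt s y} \ A), s,
    hU.sdiff (hfin.subset Set.sdiff_subset).isClosed, fun y hy => ⟨hAU hy, fun h => h.2 hy⟩, ?_,
    hs, hfin.subset fun y hy => ⟨hy.1.1, hy.2⟩, ?_, hdeg⟩
  · rintro g y ⟨hy, hy'⟩
    refine ⟨hUG g y hy, fun h => hy' ⟨⟨hy, ?_⟩, fun hyA => h.2 (hA g y hyA)⟩⟩
    exact fun hr => h.1.2 (hs.isRegularAt_smul hc hr g)
  · rintro y ⟨⟨hy, hy'⟩, hr⟩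
    by_contra hyA
    exact hy' ⟨⟨hy, hr⟩, hyA⟩

variable [VectorBundle ℂ ℂ L]

/-- The point `x` and the closed set `A` have disjoint invariant neighbourhoods, so the two sections
can be put side by side with no compatibility condition. -/
theorem HasRegularSectionNear.insert_fixedPoint [Fintype G] [CompactSpace X] [T2Space X]
    (hG : IsHolomorphicAction G X) {A : Set X} (h : ρ.HasRegularSectionNear d A)
    (hcl : IsClosed A) (hA : ∀ (g : G), ∀ y ∈ A, g • y ∈ A) {x : X}
    (hx : x ∈ MulAction.fixedPoints G X) (hxA : x ∉ A) (hd : ρ.FibreIsoTangentPower x (d x)) :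
    ρ.HasRegularSectionNear d (insert x A) := by
  classical
  have hc := hG.continuous_smul
  obtain ⟨U, s, hU, hAU, hUG, hs, hfin, hdeg⟩ := h
  obtain ⟨t, ht, htr, htd⟩ := exists_equivariant_section_at_fixedPoint hG hx hd
  obtain ⟨V₀, N₀, hV₀, hN₀, hAV₀, hxN₀, hdisj⟩ := normal_separation hcl isClosed_singleton
    (Set.disjoint_singleton_right.2 hxA)
  rw [eventually_nhdsWithin_iff] at htr
  obtain ⟨N₁, hN₁, hN₁o, hxN₁⟩ := mem_nhds_iff.1 htr
  -- Intersecting all translates makes the neighbourhoods invariant; as `G` is finite they remain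
  -- open.
  set V : Set X := {y | ∀ g : G, g • y ∈ V₀} with hV
  set N : Set X := {y | ∀ g : G, g • y ∈ N₀ ∩ N₁} with hN
  have hVo : IsOpen V := isOpen_forall_smul_mem hc hV₀
  have hNo : IsOpen N := isOpen_forall_smul_mem hc (hN₀.inter hN₁o)
  have hV1 : V ⊆ V₀ := fun y hy => by simpa using hy 1
  have hN1 : N ⊆ N₀ ∩ N₁ := fun y hy => by simpa using hy 1
  have hAV : A ⊆ V := fun y hy g => hAV₀ (hA g y hy)
  have hxN : x ∈ N := fun g => by rw [hx g]; exact ⟨hxN₀ rfl, hxN₁⟩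
  have hNV : ∀ y ∈ N, y ∉ V := fun y hyN hyV =>
    Set.disjoint_left.1 hdisj (hV1 hyV) (hN1 hyN).1
  set s' : ∀ y, L y := fun y => if y ∈ V then s y else t y with hs'
  have hsV : ∀ y ∈ V, ∀ᶠ z in 𝓝 y, s' z = s z := fun y hy => by
    filter_upwards [hVo.mem_nhds hy] with z hz
    exact if_pos hz
  have hsN : ∀ y ∈ N, ∀ᶠ z in 𝓝 y, s' z = t z := fun y hy => by
    filter_upwards [hNo.mem_nhds hy] with z hz
    exact if_neg (hNV z hz)
  refine ⟨V ∩ U ∪ N, s', (hVo.inter hU).union hNo, ?_, ?_, ?_, ?_, ?_⟩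
  · rintro y (rfl | hy)
    · exact Or.inr hxN
    · exact Or.inl ⟨hAV hy, hAU hy⟩
  · rintro g y (hy | hy)
    · exact Or.inl ⟨(forall_smul_smul_mem_iff g).2 hy.1, hUG g y hy.2⟩
    · exact Or.inr ((forall_smul_smul_mem_iff g).2 hy)
  · intro g y
    by_cases hy : y ∈ V
    · have hgy : g • y ∈ V := (forall_smul_smul_mem_iff g).2 hy
      simp only [hs', if_pos hy, if_pos hgy]
      exact hs g y
    · have hgy : g • y ∉ V := fun h => hy ((forall_smul_smul_mem_iff g).1 h)
      simp only [hs', if_neg hy, if_neg hgy]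
      exact ht g y
  · refine (hfin.union (Set.finite_singleton x)).subset ?_
    rintro y ⟨hy | hy, hr⟩
    · rw [isRegularAt_congr (hsV y hy.1)] at hr
      exact Or.inl ⟨hy.2, hr⟩
    · rw [isRegularAt_congr (hsN y hy)] at hr
      by_contra hcon
      exact hr (hN₁ (hN1 hy).2 fun h => hcon (Or.inr h))
  · rintro y (rfl | hy) hyf
    · exact htd.congr ((sectionCoord_congr y (hsN y hxN)).symm.filter_mono nhdsWithin_le_nhds)
    · exact (hdeg y hy hyf).congr
        ((sectionCoord_congr y (hsV y (hAV hy))).symm.filter_mono nhdsWithin_le_nhds)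

/-- The section given by the function `h` in the coordinate disc of radius `r` around `x`, and zero
outside. -/
noncomputable def _root_.discSection (L : X → Type*) [∀ x, AddCommGroup (L x)]
    [∀ x, Module ℂ (L x)] [∀ x, TopologicalSpace (L x)] [TopologicalSpace (TotalSpace ℂ L)]
    [FiberBundle ℂ L] [VectorBundle ℂ ℂ L] (x : X) (r : ℝ) (h : ℂ → ℂ) (y : X) : L y :=
  open Classical in if y ∈ chartDisc x r then h (centredChart x y) • localFrame L x y else 0

/-- The disc is disjoint from its translates, so any section on it extends equivariantly to the
orbit by averaging. It remains to choose on the disc a function with finitely many zeros that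
continues the section already given near `A`. -/
theorem HasRegularSectionNear.union_disc [Fintype G] [Nontrivial G] [CompactSpace X] [T2Space X]
    (hG : IsHolomorphicAction G X) {A : Set X} (hA : ρ.HasRegularSectionNear d A)
    (hcl : IsClosed A) (hAG : ∀ (g : G), ∀ y ∈ A, g • y ∈ A) {x : X} {r R : ℝ}
    (hR : IsChartRadius x R) (hrR : r < R)
    (hbase : chartDisc x R ⊆ (trivializationAt ℂ L x).baseSet)
    (hfree : ∀ g : G, g ≠ 1 → ∀ y ∈ chartDisc x R, g • y ∉ chartDisc x R) :
    ρ.HasRegularSectionNear d (A ∪ {y | ∃ g : G, g • y ∈ chartClosedDisc x r}) := by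
  classical
  have hc := hG.continuous_smul
  obtain ⟨U, s, hU, hAU, hUG, hs, hfin, hbadA, hdeg⟩ := hA.shrink hAG hc
  obtain ⟨V₀, hV₀, hAV₀, hV₀U⟩ := normal_exists_closure_subset hcl hU hAU
  set V : Set X := {y | ∀ g : G, g • y ∈ V₀} with hV
  have hVG : ∀ (g : G) {y : X}, g • y ∈ V ↔ y ∈ V := fun g y => forall_smul_smul_mem_iff g
  have hVo : IsOpen V := isOpen_forall_smul_mem hc hV₀
  have hVU : closure V ⊆ U :=
    (closure_mono fun y hy => by simpa using hy 1).trans hV₀U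
  have hAV : A ⊆ V := fun y hy g => hAV₀ (hAG g y hy)
  -- The open set `W` contains the irregular points, and its closure lies in `V`. On `closure V \ W`
  -- the old section is regular, so its coordinate can be extended; inside `V` the old section is
  -- kept anyway.
  obtain ⟨W, hW, hbadW, hWV⟩ := normal_exists_closure_subset hfin.isClosed hVo
    (hbadA.trans hAV)
  obtain ⟨r', hr'⟩ := exists_between hrR
  have hdisc : chartDisc x r' ⊆ chartDisc x R := fun y hy => ⟨hy.1, hy.2.trans hr'.2⟩
  have hparam : ∀ w ∈ Metric.closedBall (0 : ℂ) r', ‖w‖ < R := fun w hw =>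
    lt_of_le_of_lt (by simpa using hw) hr'.2
  have hparamR : ∀ w : ℂ, ‖w‖ < R → centredParam x w ∈ chartDisc x R := fun w hw =>
    ⟨hR.centredParam_mem_source hw, by rwa [hR.centredChart_centredParam hw]⟩
  set K : Set ℂ := Metric.closedBall 0 r' ∩ centredParam x ⁻¹' (closure V \ W) with hK
  have hKcl : IsClosed K :=
    ContinuousOn.preimage_isClosed_of_isClosed
      (fun w hw => (hR.continuousAt_centredParam (hparam w hw)).continuousWithinAt)
      Metric.isClosed_closedBall (isClosed_closure.sdiff hW)
  have hKc : IsCompact K :=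
    (isCompact_closedBall 0 r').of_isClosed_subset hKcl Set.inter_subset_left
  have hKreg : ∀ w ∈ K, ContinuousAt (sectionCoord s x) (centredParam x w) ∧
      sectionCoord s x (centredParam x w) ≠ 0 := fun w hw => by
    rw [← isRegularAt_iff (hbase (hparamR w (hparam w hw.1)))]
    by_contra hr
    exact hw.2.2 (hbadW ⟨hVU hw.2.1, hr⟩)
  obtain ⟨h, hh, hhs, hZ⟩ := exists_extension_finite_zeros hKc
    (f := fun w => sectionCoord s x (centredParam x w))
    (fun w hw => ((hKreg w hw).1.comp
      (hR.continuousAt_centredParam (hparam w hw.1))).continuousWithinAt)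
    (fun w hw => (hKreg w hw).2) r'
  set σ := discSection L x r' h with hσ
  set s' : ∀ y, L y := fun y => if y ∈ V then s y else ρ.average σ y with hs'
  have hσin : ∀ y ∈ chartDisc x r', ρ.average σ y = h (centredChart x y) • localFrame L x y :=
    fun y hy => by
      rw [average_eq_self]
      · exact if_pos hy
      · exact fun g hg => if_neg fun hgy => hfree g hg y (hdisc hy) (hdisc hgy)
  -- Off `closure W` the single function `h` represents the new section on both sides of the
  -- boundary of `V`, so no jump occurs there.
  have hcoord : ∀ y ∈ chartDisc x r', y ∉ closure W →
      sectionCoord s' x y = h (centredChart x y) := by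
    intro y hy hyW
    by_cases hyV : y ∈ V
    · have hmem : centredChart x y ∈ K := by
        refine ⟨by simpa using hy.2.le, ?_⟩
        rw [Set.mem_preimage, centredParam_centredChart hy.1]
        exact ⟨subset_closure hyV, fun h => hyW (subset_closure h)⟩
      rw [hhs hmem]
      change _ = sectionCoord s x (centredParam x (centredChart x y))
      rw [centredParam_centredChart hy.1]
      simp only [sectionCoord, hs', if_pos hyV]
    · have hyb := hbase (hdisc hy)
      simp only [sectionCoord, hs', if_neg hyV]
      rw [hσin y hy, trivializationAt_smul hyb, trivializationAt_localFrame hyb, mul_one]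
  have hreg : ∀ y ∈ chartDisc x r', y ∉ closure W → h (centredChart x y) ≠ 0 →
      IsRegularAt s' y := by
    intro y hy hyW h0
    rw [isRegularAt_iff (hbase (hdisc hy)), hcoord y hy hyW]
    refine ⟨?_, h0⟩
    refine (hh.continuousAt.comp (continuousAt_centredChart hy.1)).congr ?_
    filter_upwards [(isOpen_chartDisc x r').mem_nhds hy,
      isClosed_closure.isOpen_compl.mem_nhds hyW] with z hz hzW
    exact (hcoord z hz hzW).symm
  have hsV : ∀ y ∈ V, ∀ᶠ z in 𝓝 y, s' z = s z := fun y hy => by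
    filter_upwards [hVo.mem_nhds hy] with z hz
    exact if_pos hz
  have hs'eq : ρ.IsEquivariant s' := by
    intro g y
    by_cases hy : y ∈ V
    · have hgy : g • y ∈ V := (hVG g).2 hy
      simp only [hs', if_pos hy, if_pos hgy]
      exact hs g y
    · have hgy : g • y ∉ V := fun h => hy ((hVG g).1 h)
      simp only [hs', if_neg hy, if_neg hgy]
      exact ρ.isEquivariant_average σ g y
  refine ⟨V ∪ {y | ∃ g : G, g • y ∈ chartDisc x r'}, s', ?_, ?_, ?_, hs'eq, ?_, ?_⟩
  · rw [Set.ofPred_exists]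
    exact hVo.union (isOpen_iUnion fun g => (isOpen_chartDisc x r').preimage (hc g))
  · exact Set.union_subset_union hAV fun y ⟨g, hg⟩ => ⟨g, hg.1, hg.2.trans_lt hr'.1⟩
  · rintro g y (hy | ⟨k, hk⟩)
    · exact Or.inl ((hVG g).2 hy)
    · exact Or.inr ⟨k * g⁻¹, by rwa [mul_smul, inv_smul_smul]⟩
  -- Irregular points in `V` are those of `s`; outside `V` they are translates of zeros of `h`.
  · have hZ' : (⋃ g : G, (fun y : X => g • y) ⁻¹' (centredParam x ''
        {z ∈ Metric.closedBall 0 r' | h z = 0})).Finite :=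
      Set.finite_iUnion fun g =>
        (hZ.image _).preimage (MulAction.injective g).injOn
    refine (hfin.union hZ').subset ?_
    rintro y ⟨hy, hr⟩
    by_cases hyV : y ∈ V
    · rw [isRegularAt_congr (hsV y hyV)] at hr
      exact Or.inl ⟨hVU (subset_closure hyV), hr⟩
    · obtain ⟨g, hg⟩ := hy.resolve_left hyV
      refine Or.inr (Set.mem_iUnion.2 ⟨g, centredChart x (g • y), ⟨by simpa using hg.2.le, ?_⟩,
        centredParam_centredChart hg.1⟩)
      by_contra h0
      exact hr ((hs'eq.isRegularAt_smul_iff hc).1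
        (hreg (g • y) hg (fun hW' => hyV ((hVG g).1 (hWV hW'))) h0))
  · rintro y (hy | ⟨g, hg⟩) hyf
    · exact (hdeg y hy hyf).congr
        ((sectionCoord_congr y (hsV y (hAV hy))).symm.filter_mono nhdsWithin_le_nhds)
    -- A fixed point in the disc would be moved off the disc by some `k ≠ 1`, so no index condition
    -- arises here.
    · obtain ⟨k, hk⟩ := exists_ne (1 : G)
      rw [hyf g] at hg
      have hy : y ∈ chartDisc x R := ⟨hg.1, hg.2.trans_lt hrR⟩
      exact absurd (by rwa [hyf k]) (hfree k hk y hy)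

end EquivariantStructure

/-! ### Orbits and neighbourhoods for a group of prime order -/

theorem finite_fixedPoints {G X : Type*} [Group G] [MulAction G X] [TopologicalSpace X]
    [CompactSpace X] [T2Space X] (hc : ∀ g : G, Continuous fun x : X => g • x)
    (hfree : IsPseudofree G X) : (MulAction.fixedPoints G X).Finite := by
  have hcl : IsClosed (MulAction.fixedPoints G X) := by
    have : MulAction.fixedPoints G X = ⋂ g : G, {x | g • x = x} := by
      ext x; simp [MulAction.mem_fixedPoints]
    rw [this]
    exact isClosed_iInter fun g => isClosed_eq (hc g) continuous_id
  refine hcl.isCompact.finite (isDiscrete_iff_nhdsNE.2 fun x hx => ?_)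
  rw [inf_principal_eq_bot]
  exact hfree x hx

/-- A stabilizer is a subgroup of a group of prime order, hence trivial or everything. -/
theorem smul_ne_of_prime_card {G X : Type*} [Group G] [MulAction G X] {p : ℕ} (hp : p.Prime)
    (hcard : Nat.card G = p) {x : X} (hx : x ∉ MulAction.fixedPoints G X) {g : G} (hg : g ≠ 1) :
    g • x ≠ x := by
  have : Fact (Nat.card G).Prime := ⟨by rwa [hcard]⟩
  intro h
  rcases (MulAction.stabilizer G x).eq_bot_or_eq_top_of_prime_card with hb | ht
  · exact hg ((Subgroup.mem_bot).1 (hb ▸ (MulAction.mem_stabilizer_iff.2 h)))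
  · exact hx fun k => MulAction.mem_stabilizer_iff.1 (ht ▸ Subgroup.mem_top k)

/-- The sum of an invariant function that vanishes at the fixed points of a group of prime order
is divisible by the order. -/
theorem prime_dvd_finsum {G X : Type*} [Group G] [MulAction G X] {p : ℕ} (hp : p.Prime)
    (hcard : Nat.card G = p) {u : X → ℤ} (hu : ∀ (g : G) x, u (g • x) = u x)
    (hfin : (Function.support u).Finite) (h0 : ∀ x ∈ MulAction.fixedPoints G X, u x = 0) :
    (p : ℤ) ∣ ∑ᶠ x, u x := by
  classical
  have : Finite G := Nat.finite_of_card_ne_zero (by rw [hcard]; exact hp.ne_zero)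
  have : Fintype G := Fintype.ofFinite G
  rw [finsum_eq_sum_of_support_subset u (s := hfin.toFinset) (by simp)]
  set S := hfin.toFinset with hS
  have hmem : ∀ x, x ∈ S ↔ u x ≠ 0 := fun x => by simp [hS]
  let orb : X → MulAction.orbitRel.Quotient G X := Quotient.mk _
  rw [← Finset.sum_fiberwise_of_maps_to (t := S.image orb) (g := orb)
    (fun x hx => Finset.mem_image_of_mem _ hx)]
  refine Finset.dvd_sum fun b hb => ?_
  obtain ⟨a, ha, rfl⟩ := Finset.mem_image.1 hb
  have hfix : a ∉ MulAction.fixedPoints G X := fun h => (hmem a).1 ha (h0 a h)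
  have hinj : Function.Injective fun g : G => g • a := by
    intro g k hgk
    by_contra hne
    refine smul_ne_of_prime_card hp hcard hfix (g := k⁻¹ * g)
      (fun h => hne (inv_mul_eq_one.1 h).symm) ?_
    have hgk' : g • a = k • a := hgk
    rw [mul_smul, hgk', inv_smul_smul]
  -- The support is invariant, so it contains the whole orbit of `a`, which is free and contributes
  -- `p` equal terms.
  have himage : {x ∈ S | orb x = orb a} = Finset.univ.image fun g : G => g • a := by
    ext x
    simp only [Finset.mem_filter, Finset.mem_image, Finset.mem_univ, true_and]
    constructor
    · rintro ⟨-, h⟩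
      exact MulAction.mem_orbit_iff.1 (MulAction.orbitRel_apply.1 (Quotient.exact h))
    · rintro ⟨g, rfl⟩
      refine ⟨(hmem _).2 (by rw [hu]; exact (hmem a).1 ha), Quotient.sound ?_⟩
      exact MulAction.orbitRel_apply.2 ⟨g, rfl⟩
  rw [himage, Finset.sum_image fun _ _ _ _ h => hinj h]
  simp only [hu, Finset.sum_const, Finset.card_univ, ← Nat.card_eq_fintype_card, hcard,
    nsmul_eq_mul]
  exact dvd_mul_right _ _

theorem exists_chartDisc_subset {X : Type*} [TopologicalSpace X] [ChartedSpace ℂ X] {x : X}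
    {N : Set X} (hN : N ∈ 𝓝 x) : ∃ R, IsChartRadius x R ∧ chartDisc x R ⊆ N := by
  obtain ⟨R, hR⟩ := exists_isChartRadius x
  have h1 : ∀ᶠ w in 𝓝 (0 : ℂ), centredParam x w ∈ N := by
    have := hR.continuousAt_centredParam (w := 0) (by simpa using hR.1)
    rw [ContinuousAt, centredParam_zero] at this
    exact this hN
  obtain ⟨ε, hε, h⟩ := Metric.mem_nhds_iff.1 h1
  refine ⟨min R ε, hR.mono (lt_min hR.1 hε) (min_le_left _ _), fun y hy => ?_⟩
  have := h (show centredChart x y ∈ Metric.ball 0 ε by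
    simpa using hy.2.trans_le (min_le_right _ _))
  rwa [Set.mem_ofPred_eq, centredParam_centredChart hy.1] at this

/-- For each `g ≠ 1` the Hausdorff property separates `x` from `g • x`; finitely many such
neighbourhoods are intersected. -/
theorem exists_free_nhds {G X : Type*} [Group G] [Finite G] [MulAction G X] [TopologicalSpace X]
    [T2Space X] (hc : ∀ g : G, Continuous fun x : X => g • x) {x : X}
    (hx : ∀ g : G, g ≠ 1 → g • x ≠ x) :
    ∃ N ∈ 𝓝 x, ∀ g : G, g ≠ 1 → ∀ y ∈ N, g • y ∉ N := by
  have key : ∀ g : G, ∃ N ∈ 𝓝 x, g ≠ 1 → ∀ y ∈ N, g • y ∉ N := by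
    intro g
    by_cases hg : g = 1
    · exact ⟨Set.univ, univ_mem, fun h => absurd hg h⟩
    · obtain ⟨u, v, hu, hv, hxu, hgv, hd⟩ := t2_separation (hx g hg).symm
      refine ⟨u ∩ (fun y => g • y) ⁻¹' v,
        inter_mem (hu.mem_nhds hxu) ((hc g).continuousAt (hv.mem_nhds hgv)), fun _ y hy hgy => ?_⟩
      exact Set.disjoint_left.1 hd hgy.1 hy.2
  choose N hN hfree using key
  exact ⟨⋂ g, N g, iInter_mem.2 hN, fun g hg y hy hgy =>
    hfree g hg y (Set.mem_iInter.1 hy g) (Set.mem_iInter.1 hgy g)⟩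

/-! ### The global equivariant section and the congruence -/

namespace EquivariantStructure

variable {G X : Type*} [Group G] [MulAction G X] [TopologicalSpace X]
  [ChartedSpace ℂ X] {L : X → Type*}
  [∀ x, AddCommGroup (L x)] [∀ x, Module ℂ (L x)] [∀ x, TopologicalSpace (L x)]
  [TopologicalSpace (TotalSpace ℂ L)] [FiberBundle ℂ L] [VectorBundle ℂ ℂ L]
  [CompactSpace X] [T2Space X] {ρ : EquivariantStructure G L} {d : X → ℤ}

theorem hasRegularSectionNear_fixedPoints [Fintype G] (hG : IsHolomorphicAction G X)
    (hfree : IsPseudofree G X)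
    (hd : ∀ x ∈ MulAction.fixedPoints G X, ρ.FibreIsoTangentPower x (d x)) :
    ρ.HasRegularSectionNear d (MulAction.fixedPoints G X) := by
  refine (finite_fixedPoints hG.continuous_smul hfree).induction_on_subset
    (motive := fun A _ => ρ.HasRegularSectionNear d A) _ hasRegularSectionNear_empty ?_
  intro x A hx hA hxA ih
  exact ih.insert_fixedPoint hG
    ((finite_fixedPoints hG.continuous_smul hfree).subset hA).isClosed
    (fun g y hy => by rwa [hA hy g]) hx hxA (hd x hx)

/-- Over a closed Riemann surface, a line bundle that is equivariant for the pseudofree action of a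
group of prime order has an equivariant section with finitely many zeros, with prescribed indices at
the fixed points. -/
theorem exists_isEquivariant_isGenericSection {p : ℕ} (hp : p.Prime) (hcard : Nat.card G = p)
    (hG : IsHolomorphicAction G X) (hfree : IsPseudofree G X)
    (hd : ∀ x ∈ MulAction.fixedPoints G X, ρ.FibreIsoTangentPower x (d x)) :
    ∃ s : ∀ x, L x, ρ.IsEquivariant s ∧ IsGenericSection s ∧
      ∀ x ∈ MulAction.fixedPoints G X, sectionDegree s x = d x := by
  have : Finite G := Nat.finite_of_card_ne_zero (by rw [hcard]; exact hp.ne_zero)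
  have : Fintype G := Fintype.ofFinite G
  have : Nontrivial G := Finite.one_lt_card_iff_nontrivial.1 (by rw [hcard]; exact hp.one_lt)
  have hc := hG.continuous_smul
  have hfixcl := (finite_fixedPoints hc hfree).isClosed
  obtain ⟨U, s, hU, hFU, hUG, hs, hfin, hdeg⟩ := hasRegularSectionNear_fixedPoints hG hfree hd
  obtain ⟨V, hV, hFV, hVU⟩ := normal_exists_closure_subset hfixcl hU hFU
  -- A closed invariant set on which a section is already available and which contains an open
  -- neighbourhood `V₀` of the fixed points. The complement of `V₀` is compact with free action.
  set A₀ : Set X := {y | ∀ g : G, g • y ∈ closure V} with hA₀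
  have hA₀cl : IsClosed A₀ := by
    rw [hA₀, Set.ofPred_forall]
    exact isClosed_iInter fun g => isClosed_closure.preimage (hc g)
  have hA₀G : ∀ (g : G), ∀ y ∈ A₀, g • y ∈ A₀ := fun g y hy => (forall_smul_smul_mem_iff g).2 hy
  have hA₀U : A₀ ⊆ U := fun y hy => hVU (by simpa using hy 1)
  have hA₀s : ρ.HasRegularSectionNear d A₀ :=
    ⟨U, s, hU, hA₀U, hUG, hs, hfin, fun x _ hx => hdeg x hx hx⟩
  set V₀ : Set X := {y | ∀ g : G, g • y ∈ V} with hV₀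
  have hV₀o : IsOpen V₀ := isOpen_forall_smul_mem hc hV
  have hFV₀ : MulAction.fixedPoints G X ⊆ V₀ := fun y hy g => by rw [hy g]; exact hFV hy
  have hVA₀ : V₀ ⊆ A₀ := fun y hy g => subset_closure (hy g)
  have hdisc : ∀ x : X, ∃ R, IsChartRadius x R ∧ (x ∉ V₀ →
      chartDisc x R ⊆ (trivializationAt ℂ L x).baseSet ∧
      ∀ g : G, g ≠ 1 → ∀ y ∈ chartDisc x R, g • y ∉ chartDisc x R) := by
    intro x
    by_cases hx : x ∈ V₀
    · obtain ⟨R, hR⟩ := exists_isChartRadius x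
      exact ⟨R, hR, fun h => absurd hx h⟩
    · obtain ⟨N, hN, hNf⟩ := exists_free_nhds hc fun g hg =>
        smul_ne_of_prime_card hp hcard (fun h => hx (hFV₀ h)) hg
      obtain ⟨R, hR, hsub⟩ := exists_chartDisc_subset (inter_mem hN
        (eventually_mem_baseSet L (FiberBundle.mem_baseSet_trivializationAt ℂ L x)))
      exact ⟨R, hR, fun _ => ⟨fun y hy => (hsub hy).2, fun g hg y hy hgy =>
        hNf g hg y (hsub hy).1 (hsub hgy).1⟩⟩
  choose R hR hRf using hdisc
  have hlt : ∀ x, R x / 2 < R x := fun x => half_lt_self (hR x).1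
  obtain ⟨t, htV, ht⟩ := hV₀o.isClosed_compl.isCompact.elim_nhds_subcover
    (fun x => chartDisc x (R x / 2)) fun x _ =>
      (isOpen_chartDisc x _).mem_nhds (mem_chartDisc_self (half_pos (hR x).1))
  -- The section is extended over one disc and all its translates at a time, the set reached
  -- remaining closed and invariant.
  have key : ∀ t : Finset X, (∀ x ∈ t, x ∉ V₀) → ∃ A : Set X, IsClosed A ∧
      (∀ (g : G), ∀ y ∈ A, g • y ∈ A) ∧ A₀ ⊆ A ∧
      (∀ x ∈ t, chartDisc x (R x / 2) ⊆ A) ∧ ρ.HasRegularSectionNear d A := by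
    classical
    intro t
    induction t using Finset.induction_on with
    | empty => exact fun _ => ⟨A₀, hA₀cl, hA₀G, subset_rfl, by simp, hA₀s⟩
    | insert x t _ ih =>
      intro hxt
      obtain ⟨A, h1, h2, h3, h4, h5⟩ := ih fun y hy => hxt y (Finset.mem_insert_of_mem hy)
      obtain ⟨hb, hf⟩ := hRf x (hxt x (Finset.mem_insert_self x t))
      refine ⟨_, h1.union ?_, ?_, h3.trans Set.subset_union_left, ?_,
        h5.union_disc hG h1 h2 (hR x) (hlt x) hb hf⟩
      · rw [Set.ofPred_exists]
        exact isClosed_iUnion_of_finite fun g =>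
          ((hR x).isClosed_chartClosedDisc (hlt x)).preimage (hc g)
      · rintro g y (hy | ⟨k, hk⟩)
        · exact Or.inl (h2 g y hy)
        · exact Or.inr ⟨k * g⁻¹, by rwa [mul_smul, inv_smul_smul]⟩
      · intro z hz
        rcases Finset.mem_insert.1 hz with rfl | hz
        · exact fun y hy => Or.inr ⟨1, by rw [one_smul]; exact chartDisc_subset _ _ hy⟩
        · exact (h4 z hz).trans Set.subset_union_left
  obtain ⟨A, -, -, h3, h4, U', s', -, hAU', -, hs', hfin', hdeg'⟩ := key t htV
  have hA : ∀ y, y ∈ A := fun y => by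
    by_cases hy : y ∈ V₀
    · exact h3 (hVA₀ hy)
    · obtain ⟨x, hx, hyx⟩ := Set.mem_iUnion₂.1 (ht hy)
      exact h4 x hx hyx
  exact ⟨s', hs', hfin'.subset fun y hy => ⟨hAU' (hA y), hy⟩, fun x hx =>
    (hdeg' x (hA x) hx).localDegree_eq⟩

/-- The first Chern number of an equivariant line bundle is determined modulo `p` by the
representations on the fibres at the fixed points. -/
theorem chernNumber_modEq [IsManifold 𝓘(ℂ) 1 X] {p : ℕ} (hp : p.Prime) (hcard : Nat.card G = p)
    (hG : IsHolomorphicAction G X) (hfree : IsPseudofree G X) (D : X →₀ ℤ)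
    (hD : ↑D.support ⊆ MulAction.fixedPoints G X) (ρ : EquivariantStructure G L)
    (hρ : ∀ x ∈ MulAction.fixedPoints G X, ρ.FibreIsoTangentPower x (D x)) :
    chernNumber L ≡ D.sum (fun _ d => d) [ZMOD p] := by
  obtain ⟨s, hs, hgen, hdeg⟩ :=
    exists_isEquivariant_isGenericSection hp hcard hG hfree hρ
  have hDfin : (Function.support D).Finite := D.hasFiniteSupport
  have hsum : D.sum (fun _ d => d) = ∑ᶠ x, D x :=
    (finsum_eq_sum_of_support_subset _ fun q hq => by simpa using hq).symm
  refine Int.ModEq.symm (Int.modEq_iff_dvd.2 ?_)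
  -- The difference of the two sides is the sum of index minus `D`, an invariant function that
  -- vanishes at the fixed points.
  rw [hgen.chernNumber_eq, hsum, ← finsum_sub_distrib hgen.finite_support hDfin]
  refine prime_dvd_finsum hp hcard (fun g x => ?_) ?_ fun x hx => ?_
  · rw [hs.sectionDegree_smul hG hgen, divisor_smul_apply hD]
  · exact (hgen.finite_support.union hDfin).subset (Function.support_sub _ _)
  · rw [hdeg x hx, sub_self]

end EquivariantStructure

theorem mainTheorem6 {p : ℕ} (hp : p.Prime)
    {G : Type*} [Group G] (hcard : Nat.card G = p)
    {X : Type*} [TopologicalSpace X] [T2Space X] [CompactSpace X] [ConnectedSpace X]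
    [ChartedSpace ℂ X] [IsManifold 𝓘(ℂ) 1 X]
    [MulAction G X] (hG : IsHolomorphicAction G X) (hfree : IsPseudofree G X)
    (D : X →₀ ℤ) (hD : ↑D.support ⊆ MulAction.fixedPoints G X)
    {L : X → Type*} [∀ x, AddCommGroup (L x)] [∀ x, Module ℂ (L x)]
    [∀ x, TopologicalSpace (L x)] [TopologicalSpace (TotalSpace ℂ L)]
    [FiberBundle ℂ L] [VectorBundle ℂ ℂ L]
    (ρ : EquivariantStructure G L)
    (hρ : ∀ x ∈ MulAction.fixedPoints G X, ρ.FibreIsoTangentPower x (D x)) :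
    (∀ x ∈ MulAction.fixedPoints G X,
      (divisorEquivariantStructure hG D hD).FibreIsoTangentPower x (D x)) ∧
    chernNumber (divisorBundle D).Fiber = D.sum (fun _ d => d) ∧
    chernNumber L ≡ chernNumber (divisorBundle D).Fiber [ZMOD p] := by
  refine ⟨fun x hx => fibreIsoTangentPower_divisorBundle hG D hD hx,
    chernNumber_divisorBundle D, ?_⟩
  rw [chernNumber_divisorBundle D]
  exact EquivariantStructure.chernNumber_modEq hp hcard hG hfree D hD ρ hρ
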